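/- Let $G$ be a finite group, let $k$ be a $G$-Tambara functor, and let $\ell$ be a $k$-algebra (a Tambara functor with a morphism $k\to\ell$) which is flat as a $k$-module, i.e. the functor $\ell\boxtimes_k -$ on $k$-modules is exact. Assume that either 1. $\ell$ is cohomological, i.e. $\mathrm{Tr}_H^K\mathrm{Res}_H^K$ is multiplication by $[K:H]$ on $\ell(G/K)$ for all $H\le K\le G$, and $|G|$ is invertible in the ring $\ell(G/G)$; or 2. all transfers $\mathrm{Tr}_H^K:\ell(G/H)\to\ell(G/K)$, $H\le K\le G$, are surjective. Then $\ell$ is formally étale over $k$ if and only if the ring $\ell(G/e)$ is formally étale over $k(G/e)$. If moreover $\ell$ is finitely presented over $k$, then $\ell$ is étale over $k$ if and only if $\ell(G/e)$ is étale over $k(G/e)$. Here a morphism $k\to R$ of Tambara functors is called *formally étale* if $R$ is a flat $k$-module and the genuine Kähler differentials $\Omega^{1,\mathrm{Tamb}}_{R/k}=I/I^{>1}$ vanish, where $I$ is the kernel of the multiplication $R\boxtimes_k R\to R$ and $I^{>1}\subseteq I$ is the ideal generated by all products of two elements of $I$ and all norms of elements of $I$ along non-injective maps $G/K\to G/H$.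 Correspondingly, a homomorphism $A\to B$ of commutative rings is called *formally étale* here if $B$ is flat over $A$ and $\Omega^1_{B/A}=0$. The algebra $R$ is *finitely presented* over $k$ if it is a coequalizer, in $k$-algebras, of two maps between free polynomial $k$-algebras $k[x_i]$ on finitely many generators $x_i$ in levels $X_i$ (finite $G$-sets), where $k[x_i]$ represents $S\mapsto\prod_i S(X_i)$. It is *étale* if it is formally étale and finitely presented; for commutative rings, étale has its usual meaning. -/

import Mathlib

universe v u u₁ u₂ w w₁ w₂

/-! ## Finite `G`-sets -/

/-- A finite `G`-set. -/
structure FinGSet (G : Type v) [Group G] : Type (v + 1) where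
  carrier : Type v
  [finite : Finite carrier]
  [action : MulAction G carrier]

attribute [instance] FinGSet.finite FinGSet.action

namespace FinGSet

variable {G : Type v} [Group G]

instance : CoeSort (FinGSet G) (Type v) := ⟨FinGSet.carrier⟩

/-- The orbit `G/H`. -/
def orbit [Finite G] (H : Subgroup G) : FinGSet G where
  carrier := G ⧸ H

/-- The projection `G/H → G/K` for `H ≤ K`. -/
def proj [Finite G] {H K : Subgroup G} (h : H ≤ K) : orbit H →[G] orbit K where
  toFun := Subgroup.quotientMapOfLE h
  map_smul' := by
    rintro g ⟨x⟩
    rfl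

/-- The square `f ∘ p₁ = g ∘ p₂` is a pullback square of finite `G`-sets. -/
structure IsPullback {P X Y Z : FinGSet G} (p₁ : P →[G] X) (p₂ : P →[G] Y)
    (f : X →[G] Z) (g : Y →[G] Z) : Prop where
  comm : ∀ c, f (p₁ c) = g (p₂ c)
  existsUnique : ∀ x y, f x = g y → ∃! c, p₁ c = x ∧ p₂ c = y

/-- The maps `i` and `j` exhibit `Z` as the disjoint union of `X` and `Y`. -/
def IsDisjointUnion {X Y Z : FinGSet G} (i : X →[G] Z) (j : Y →[G] Z) : Prop :=
  Function.Bijective (Sum.elim i j)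

/-- The diagram `X ←p- A ←e- E -f'→ P -q→ Y` is an exponential diagram over `f : X → Y`:
`P = Π_f A` is the set of pairs of a point `y` of `Y` and a section `s : f⁻¹(y) → A` of `p`
over the fibre of `f`, `E = X ×_Y P`, and `e` evaluates a section at a point. -/
structure IsExponential {A X Y E P : FinGSet G} (p : A →[G] X) (f : X →[G] Y)
    (e : E →[G] A) (f' : E →[G] P) (q : P →[G] Y) : Prop where
  comm : ∀ z, f (p (e z)) = q (f' z)
  existsUnique_point : ∀ x c, f x = q c → ∃! z, p (e z) = x ∧ f' z = c
  existsUnique_section : ∀ (y : Y) (s : {x : X // f x = y} → A), (∀ x, p (s x) = x) →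
    ∃! c : P, q c = y ∧ ∀ z, f' z = c → ∀ x : {x : X // f x = y}, p (e z) = x → e z = s x

end FinGSet

/-! ## Tambara functors -/

/-- A `G`-Tambara functor: a commutative ring `T(X)` for every finite `G`-set `X`, with
restrictions, transfers and norms along the maps of finite `G`-sets which are functorial, send
disjoint unions to products, satisfy base change along pullback squares, and distribute norms
over transfers along exponential diagrams. (Frobenius reciprocity `tr_mul_res` is the case of
distributivity in which `f` is a fold map; it is listed for convenience.) -/
structure TambaraFunctor (G : Type v) [Group G] where
  obj : FinGSet G → Type u
  [ring : ∀ X, CommRing (obj X)]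
  res : ∀ {X Y : FinGSet G}, (X →[G] Y) → (obj Y →+* obj X)
  tr : ∀ {X Y : FinGSet G}, (X →[G] Y) → (obj X →+ obj Y)
  nm : ∀ {X Y : FinGSet G}, (X →[G] Y) → (obj X →* obj Y)
  res_id : ∀ {X : FinGSet G} (a : obj X), res (MulActionHom.id G : X →[G] X) a = a
  res_comp : ∀ {X Y Z : FinGSet G} (g : Y →[G] Z) (f : X →[G] Y) (a : obj Z),
    res (g.comp f : X →[G] Z) a = res f (res g a)
  tr_id : ∀ {X : FinGSet G} (a : obj X), tr (MulActionHom.id G : X →[G] X) a = a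
  tr_comp : ∀ {X Y Z : FinGSet G} (g : Y →[G] Z) (f : X →[G] Y) (a : obj X),
    tr (g.comp f : X →[G] Z) a = tr g (tr f a)
  nm_id : ∀ {X : FinGSet G} (a : obj X), nm (MulActionHom.id G : X →[G] X) a = a
  nm_comp : ∀ {X Y Z : FinGSet G} (g : Y →[G] Z) (f : X →[G] Y) (a : obj X),
    nm (g.comp f : X →[G] Z) a = nm g (nm f a)
  subsingleton_of_isEmpty : ∀ X : FinGSet G, IsEmpty X → Subsingleton (obj X)
  bijective_of_isDisjointUnion : ∀ {X Y Z : FinGSet G} (i : X →[G] Z) (j : Y →[G] Z),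
    FinGSet.IsDisjointUnion i j → Function.Bijective fun a : obj Z => (res i a, res j a)
  res_tr : ∀ {P X Y Z : FinGSet G} (p₁ : P →[G] X) (p₂ : P →[G] Y) (f : X →[G] Z) (g : Y →[G] Z),
    FinGSet.IsPullback p₁ p₂ f g → ∀ a : obj X, res g (tr f a) = tr p₂ (res p₁ a)
  res_nm : ∀ {P X Y Z : FinGSet G} (p₁ : P →[G] X) (p₂ : P →[G] Y) (f : X →[G] Z) (g : Y →[G] Z),
    FinGSet.IsPullback p₁ p₂ f g → ∀ a : obj X, res g (nm f a) = nm p₂ (res p₁ a)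
  tr_mul_res : ∀ {X Y : FinGSet G} (f : X →[G] Y) (a : obj X) (b : obj Y),
    tr f (a * res f b) = tr f a * b
  nm_tr : ∀ {A X Y E P : FinGSet G} (p : A →[G] X) (f : X →[G] Y)
    (e : E →[G] A) (f' : E →[G] P) (q : P →[G] Y),
    FinGSet.IsExponential p f e f' q → ∀ a : obj A, nm f (tr p a) = tr q (nm f' (res e a))

namespace TambaraFunctor

attribute [instance] TambaraFunctor.ring

variable {G : Type v} [Group G]

/-- Morphisms of Tambara functors. A Tambara functor `R` with a morphism `k ⟶ R` is a
`k`-algebra. -/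
structure Hom (S : TambaraFunctor.{v, u₁} G) (T : TambaraFunctor.{v, u₂} G) where
  app : ∀ X, S.obj X →+* T.obj X
  app_res : ∀ {X Y : FinGSet G} (f : X →[G] Y) (a : S.obj Y),
    app X (S.res f a) = T.res f (app Y a)
  app_tr : ∀ {X Y : FinGSet G} (f : X →[G] Y) (a : S.obj X),
    app Y (S.tr f a) = T.tr f (app X a)
  app_nm : ∀ {X Y : FinGSet G} (f : X →[G] Y) (a : S.obj X),
    app Y (S.nm f a) = T.nm f (app X a)

/-- Composition of morphisms of Tambara functors. -/
def Hom.comp {R : TambaraFunctor.{v, u} G} {S : TambaraFunctor.{v, u₁} G}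
    {T : TambaraFunctor.{v, u₂} G} (g : Hom S T) (f : Hom R S) : Hom R T where
  app X := (g.app X).comp (f.app X)
  app_res h a := by simp [f.app_res, g.app_res]
  app_tr h a := by simp [f.app_tr, g.app_tr]
  app_nm h a := by simp [f.app_nm, g.app_nm]

/-- `T` is cohomological: `Tr_H^K Res_H^K` is multiplication by the index `[K : H]`. -/
def IsCohomological [Finite G] (T : TambaraFunctor.{v, u} G) : Prop :=
  ∀ (H K : Subgroup G) (h : H ≤ K) (a : T.obj (FinGSet.orbit K)),
    T.tr (FinGSet.proj h) (T.res (FinGSet.proj h) a) = (H.relIndex K : T.obj (FinGSet.orbit K)) * a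

/-- All transfers `Tr_H^K` of `T` are surjective. -/
def TransfersSurjective [Finite G] (T : TambaraFunctor.{v, u} G) : Prop :=
  ∀ (H K : Subgroup G) (h : H ≤ K), Function.Surjective (T.tr (FinGSet.proj h))

/-! ## Modules, the box product, and flatness -/

/-- A module over a Tambara functor `k`, that is, over its underlying Green functor: a Mackey
functor `M` with a `k(X)`-module structure on every `M(X)`, such that restrictions are semilinear
and both Frobenius formulas hold. -/
structure Mod (k : TambaraFunctor.{v, u} G) where
  obj : FinGSet G → Type w
  [addCommGroup : ∀ X, AddCommGroup (obj X)]
  [module : ∀ X, Module (k.obj X) (obj X)]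
  res : ∀ {X Y : FinGSet G}, (X →[G] Y) → (obj Y →+ obj X)
  tr : ∀ {X Y : FinGSet G}, (X →[G] Y) → (obj X →+ obj Y)
  res_id : ∀ {X : FinGSet G} (m : obj X), res (MulActionHom.id G : X →[G] X) m = m
  res_comp : ∀ {X Y Z : FinGSet G} (g : Y →[G] Z) (f : X →[G] Y) (m : obj Z),
    res (g.comp f : X →[G] Z) m = res f (res g m)
  tr_id : ∀ {X : FinGSet G} (m : obj X), tr (MulActionHom.id G : X →[G] X) m = m
  tr_comp : ∀ {X Y Z : FinGSet G} (g : Y →[G] Z) (f : X →[G] Y) (m : obj X),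
    tr (g.comp f : X →[G] Z) m = tr g (tr f m)
  subsingleton_of_isEmpty : ∀ X : FinGSet G, IsEmpty X → Subsingleton (obj X)
  bijective_of_isDisjointUnion : ∀ {X Y Z : FinGSet G} (i : X →[G] Z) (j : Y →[G] Z),
    FinGSet.IsDisjointUnion i j → Function.Bijective fun m : obj Z => (res i m, res j m)
  res_tr : ∀ {P X Y Z : FinGSet G} (p₁ : P →[G] X) (p₂ : P →[G] Y) (f : X →[G] Z) (g : Y →[G] Z),
    FinGSet.IsPullback p₁ p₂ f g → ∀ m : obj X, res g (tr f m) = tr p₂ (res p₁ m)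
  res_smul : ∀ {X Y : FinGSet G} (f : X →[G] Y) (a : k.obj Y) (m : obj Y),
    res f (a • m) = k.res f a • res f m
  tr_res_smul : ∀ {X Y : FinGSet G} (f : X →[G] Y) (a : k.obj Y) (m : obj X),
    tr f (k.res f a • m) = a • tr f m
  tr_smul_res : ∀ {X Y : FinGSet G} (f : X →[G] Y) (a : k.obj X) (m : obj Y),
    tr f (a • res f m) = k.tr f a • m

namespace Mod

attribute [instance] Mod.addCommGroup Mod.module

variable {k : TambaraFunctor.{v, u} G}

/-- Morphisms of `k`-modules. -/
structure Hom (M : Mod.{v, u, w₁} k) (N : Mod.{v, u, w₂} k) where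
  app : ∀ X, M.obj X →ₗ[k.obj X] N.obj X
  app_res : ∀ {X Y : FinGSet G} (f : X →[G] Y) (m : M.obj Y),
    app X (M.res f m) = N.res f (app Y m)
  app_tr : ∀ {X Y : FinGSet G} (f : X →[G] Y) (m : M.obj X),
    app Y (M.tr f m) = N.tr f (app X m)

/-- The symbols generating `(M ⊠_k N)(X)`: the triple `(f : Y → X, m, n)` stands for the transfer
along `f` of `m ⊗ n`, where `m ∈ M(Y)` and `n ∈ N(Y)`. -/
abbrev BoxSymbol (M : Mod.{v, u, w₁} k) (N : Mod.{v, u, w₂} k) (X : FinGSet G) :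
    Type (max (v + 1) w₁ w₂) :=
  Σ Y : FinGSet G, (Y →[G] X) × M.obj Y × N.obj Y

/-- The element `tr_f (m ⊗ n)` of the free abelian group on the symbols. -/
def boxGen (M : Mod.{v, u, w₁} k) (N : Mod.{v, u, w₂} k) {X Y : FinGSet G} (f : Y →[G] X)
    (m : M.obj Y) (n : N.obj Y) : FreeAbelianGroup (BoxSymbol M N X) :=
  FreeAbelianGroup.of ⟨Y, f, m, n⟩

/-- The relations of the box product over `k`: biadditivity, `k`-balance, and Frobenius
reciprocity in both variables. -/
inductive BoxRel (M : Mod.{v, u, w₁} k) (N : Mod.{v, u, w₂} k) (X : FinGSet G) :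
    FreeAbelianGroup (BoxSymbol M N X) → Prop
  | add_left {Y : FinGSet G} (f : Y →[G] X) (m m' : M.obj Y) (n : N.obj Y) :
      BoxRel M N X (boxGen M N f (m + m') n - (boxGen M N f m n + boxGen M N f m' n))
  | add_right {Y : FinGSet G} (f : Y →[G] X) (m : M.obj Y) (n n' : N.obj Y) :
      BoxRel M N X (boxGen M N f m (n + n') - (boxGen M N f m n + boxGen M N f m n'))
  | smul {Y : FinGSet G} (f : Y →[G] X) (a : k.obj Y) (m : M.obj Y) (n : N.obj Y) :
      BoxRel M N X (boxGen M N f (a • m) n - boxGen M N f m (a • n))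
  | tr_left {Y Z : FinGSet G} (f : Y →[G] X) (h : Z →[G] Y) (m : M.obj Z) (n : N.obj Y) :
      BoxRel M N X (boxGen M N f (M.tr h m) n - boxGen M N (f.comp h : Z →[G] X) m (N.res h n))
  | tr_right {Y Z : FinGSet G} (f : Y →[G] X) (h : Z →[G] Y) (m : M.obj Y) (n : N.obj Z) :
      BoxRel M N X (boxGen M N f m (N.tr h n) - boxGen M N (f.comp h : Z →[G] X) (M.res h m) n)

/-- The value `(M ⊠_k N)(X)` of the box product over `k` at the finite `G`-set `X`. -/
def Box (M : Mod.{v, u, w₁} k) (N : Mod.{v, u, w₂} k) (X : FinGSet G) :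
    Type (max (v + 1) w₁ w₂) :=
  FreeAbelianGroup (BoxSymbol M N X) ⧸ AddSubgroup.closure {z | BoxRel M N X z}

instance (M : Mod.{v, u, w₁} k) (N : Mod.{v, u, w₂} k) (X : FinGSet G) :
    AddCommGroup (Box M N X) :=
  inferInstanceAs (AddCommGroup (_ ⧸ _))

/-- The map `(M ⊠_k g)(X)`, sending `tr_f (m ⊗ n)` to `tr_f (m ⊗ g(n))`. -/
def boxMap (M : Mod.{v, u, w} k) {N : Mod.{v, u, w₁} k} {N' : Mod.{v, u, w₂} k} (g : Hom N N')
    (X : FinGSet G) : Box M N X →+ Box M N' X :=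
  QuotientAddGroup.map _ _
    (FreeAbelianGroup.map fun s : BoxSymbol M N X =>
      (⟨s.1, s.2.1, s.2.2.1, g.app s.1 s.2.2.2⟩ : BoxSymbol M N' X)) <| by
    have key : ∀ {Y : FinGSet G} (f : Y →[G] X) (m : M.obj Y) (n : N.obj Y),
        FreeAbelianGroup.map (fun s : BoxSymbol M N X =>
          (⟨s.1, s.2.1, s.2.2.1, g.app s.1 s.2.2.2⟩ : BoxSymbol M N' X)) (boxGen M N f m n) =
          boxGen M N' f m (g.app Y n) :=
      fun _ _ _ => FreeAbelianGroup.map_of_apply _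
    rw [AddSubgroup.closure_le]
    intro z hz
    refine AddSubgroup.subset_closure ?_
    cases hz with
    | add_left f m m' n => simp only [map_sub, map_add, key]; exact .add_left ..
    | add_right f m n n' => simp only [map_sub, map_add, key]; exact .add_right ..
    | smul f a m n => simp only [map_sub, map_smul, key]; exact .smul ..
    | tr_left f h m n => simp only [map_sub, key, g.app_res]; exact .tr_left ..
    | tr_right f h m n => simp only [map_sub, key, g.app_tr]; exact .tr_right ..

/-- The `k`-module `M` is flat: the functor `M ⊠_k -` sends short exact sequences of `k`-modules
to short exact sequences. (Exactness of `k`-modules is levelwise.) -/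
def IsFlat (M : Mod.{v, u, w} k) : Prop :=
  ∀ (N₁ N₂ N₃ : Mod.{v, u, max u v} k) (f : Hom N₁ N₂) (g : Hom N₂ N₃),
    (∀ X, Function.Injective (f.app X) ∧ Function.Exact (f.app X) (g.app X) ∧
      Function.Surjective (g.app X)) →
    ∀ X, Function.Injective (boxMap M f X) ∧ Function.Exact (boxMap M f X) (boxMap M g X) ∧
      Function.Surjective (boxMap M g X)

end Mod

/-- A `k`-algebra as a `k`-module. -/
def Hom.toMod {k : TambaraFunctor.{v, u₁} G} {R : TambaraFunctor.{v, u₂} G} (φ : Hom k R) :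
    Mod.{v, u₁, u₂} k :=
  letI (X : FinGSet G) : Module (k.obj X) (R.obj X) := Module.compHom _ (φ.app X)
  { obj := R.obj
    res := fun f => (R.res f : _ →+ _)
    tr := R.tr
    res_id := R.res_id
    res_comp := R.res_comp
    tr_id := R.tr_id
    tr_comp := R.tr_comp
    subsingleton_of_isEmpty := R.subsingleton_of_isEmpty
    bijective_of_isDisjointUnion := R.bijective_of_isDisjointUnion
    res_tr := R.res_tr
    res_smul := fun {X Y} f a m => by
      change R.res f (φ.app Y a * m) = φ.app X (k.res f a) * R.res f m
      rw [map_mul, φ.app_res]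
    tr_res_smul := fun {X Y} f a m => by
      change R.tr f (φ.app X (k.res f a) * m) = φ.app Y a * R.tr f m
      rw [φ.app_res, mul_comm, R.tr_mul_res, mul_comm]
    tr_smul_res := fun {X Y} f a m => by
      change R.tr f (φ.app X a * R.res f m) = φ.app Y (k.tr f a) * m
      rw [R.tr_mul_res, φ.app_tr] }

/-! ## Tambara functors by generators and relations -/

/-- Formal expressions in generators `Gen` and the operations of a Tambara functor. -/
inductive Term (Gen : FinGSet G → Type w) : FinGSet G → Type (max (v + 1) w)
  | gen {X : FinGSet G} (x : Gen X) : Term Gen X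
  | zero {X : FinGSet G} : Term Gen X
  | one {X : FinGSet G} : Term Gen X
  | add {X : FinGSet G} (a b : Term Gen X) : Term Gen X
  | mul {X : FinGSet G} (a b : Term Gen X) : Term Gen X
  | neg {X : FinGSet G} (a : Term Gen X) : Term Gen X
  | res {X Y : FinGSet G} (f : X →[G] Y) (a : Term Gen Y) : Term Gen X
  | tr {X Y : FinGSet G} (f : X →[G] Y) (a : Term Gen X) : Term Gen Y
  | nm {X Y : FinGSet G} (f : X →[G] Y) (a : Term Gen X) : Term Gen Y

/-- The smallest congruence on formal expressions which contains the relations `rel` and the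
axioms of Tambara functors. -/
inductive TermRel {Gen : FinGSet G → Type w} (rel : ∀ X, Term Gen X → Term Gen X → Prop) :
    ∀ X : FinGSet G, Term Gen X → Term Gen X → Prop
  | of {X : FinGSet G} {a b : Term Gen X} : rel X a b → TermRel rel X a b
  | refl {X : FinGSet G} (a : Term Gen X) : TermRel rel X a a
  | symm {X : FinGSet G} {a b : Term Gen X} : TermRel rel X a b → TermRel rel X b a
  | trans {X : FinGSet G} {a b c : Term Gen X} : TermRel rel X a b → TermRel rel X b c → TermRel rel X a c
  | add_congr {X : FinGSet G} {a a' b b' : Term Gen X} : TermRel rel X a a' → TermRel rel X b b' →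
      TermRel rel X (a.add b) (a'.add b')
  | mul_congr {X : FinGSet G} {a a' b b' : Term Gen X} : TermRel rel X a a' → TermRel rel X b b' →
      TermRel rel X (a.mul b) (a'.mul b')
  | neg_congr {X : FinGSet G} {a a' : Term Gen X} : TermRel rel X a a' → TermRel rel X a.neg a'.neg
  | res_congr {X Y : FinGSet G} (f : X →[G] Y) {a a' : Term Gen Y} : TermRel rel Y a a' →
      TermRel rel X (.res f a) (.res f a')
  | tr_congr {X Y : FinGSet G} (f : X →[G] Y) {a a' : Term Gen X} : TermRel rel X a a' →
      TermRel rel Y (.tr f a) (.tr f a')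
  | nm_congr {X Y : FinGSet G} (f : X →[G] Y) {a a' : Term Gen X} : TermRel rel X a a' →
      TermRel rel Y (.nm f a) (.nm f a')
  | add_assoc {X : FinGSet G} (a b c : Term Gen X) : TermRel rel X ((a.add b).add c) (a.add (b.add c))
  | add_comm {X : FinGSet G} (a b : Term Gen X) : TermRel rel X (a.add b) (b.add a)
  | zero_add {X : FinGSet G} (a : Term Gen X) : TermRel rel X (.add .zero a) a
  | neg_add_cancel {X : FinGSet G} (a : Term Gen X) : TermRel rel X (a.neg.add a) .zero
  | mul_assoc {X : FinGSet G} (a b c : Term Gen X) : TermRel rel X ((a.mul b).mul c) (a.mul (b.mul c))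
  | mul_comm {X : FinGSet G} (a b : Term Gen X) : TermRel rel X (a.mul b) (b.mul a)
  | one_mul {X : FinGSet G} (a : Term Gen X) : TermRel rel X (.mul .one a) a
  | mul_add {X : FinGSet G} (a b c : Term Gen X) :
      TermRel rel X (a.mul (b.add c)) ((a.mul b).add (a.mul c))
  | res_one {X Y : FinGSet G} (f : X →[G] Y) : TermRel rel X (.res f .one) .one
  | res_add {X Y : FinGSet G} (f : X →[G] Y) (a b : Term Gen Y) :
      TermRel rel X (.res f (a.add b)) (.add (.res f a) (.res f b))
  | res_mul {X Y : FinGSet G} (f : X →[G] Y) (a b : Term Gen Y) :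
      TermRel rel X (.res f (a.mul b)) (.mul (.res f a) (.res f b))
  | tr_add {X Y : FinGSet G} (f : X →[G] Y) (a b : Term Gen X) :
      TermRel rel Y (.tr f (a.add b)) (.add (.tr f a) (.tr f b))
  | nm_one {X Y : FinGSet G} (f : X →[G] Y) : TermRel rel Y (.nm f .one) .one
  | nm_mul {X Y : FinGSet G} (f : X →[G] Y) (a b : Term Gen X) :
      TermRel rel Y (.nm f (a.mul b)) (.mul (.nm f a) (.nm f b))
  | res_id {X : FinGSet G} (a : Term Gen X) : TermRel rel X (.res (MulActionHom.id G : X →[G] X) a) a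
  | res_comp {X Y Z : FinGSet G} (g : Y →[G] Z) (f : X →[G] Y) (a : Term Gen Z) :
      TermRel rel X (.res (g.comp f : X →[G] Z) a) (.res f (.res g a))
  | tr_id {X : FinGSet G} (a : Term Gen X) : TermRel rel X (.tr (MulActionHom.id G : X →[G] X) a) a
  | tr_comp {X Y Z : FinGSet G} (g : Y →[G] Z) (f : X →[G] Y) (a : Term Gen X) :
      TermRel rel Z (.tr (g.comp f : X →[G] Z) a) (.tr g (.tr f a))
  | nm_id {X : FinGSet G} (a : Term Gen X) : TermRel rel X (.nm (MulActionHom.id G : X →[G] X) a) a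
  | nm_comp {X Y Z : FinGSet G} (g : Y →[G] Z) (f : X →[G] Y) (a : Term Gen X) :
      TermRel rel Z (.nm (g.comp f : X →[G] Z) a) (.nm g (.nm f a))
  | of_isEmpty {X : FinGSet G} (a b : Term Gen X) : IsEmpty X → TermRel rel X a b
  | of_isDisjointUnion {X Y Z : FinGSet G} (i : X →[G] Z) (j : Y →[G] Z) (a b : Term Gen Z) :
      FinGSet.IsDisjointUnion i j → TermRel rel X (.res i a) (.res i b) →
      TermRel rel Y (.res j a) (.res j b) → TermRel rel Z a b
  | res_tr {P X Y Z : FinGSet G} (p₁ : P →[G] X) (p₂ : P →[G] Y) (f : X →[G] Z) (g : Y →[G] Z)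
      (a : Term Gen X) : FinGSet.IsPullback p₁ p₂ f g →
      TermRel rel Y (.res g (.tr f a)) (.tr p₂ (.res p₁ a))
  | res_nm {P X Y Z : FinGSet G} (p₁ : P →[G] X) (p₂ : P →[G] Y) (f : X →[G] Z) (g : Y →[G] Z)
      (a : Term Gen X) : FinGSet.IsPullback p₁ p₂ f g →
      TermRel rel Y (.res g (.nm f a)) (.nm p₂ (.res p₁ a))
  | tr_mul_res {X Y : FinGSet G} (f : X →[G] Y) (a : Term Gen X) (b : Term Gen Y) :
      TermRel rel Y (.tr f (a.mul (.res f b))) (.mul (.tr f a) b)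
  | nm_tr {A X Y E P : FinGSet G} (p : A →[G] X) (f : X →[G] Y) (e : E →[G] A) (f' : E →[G] P)
      (q : P →[G] Y) (a : Term Gen A) : FinGSet.IsExponential p f e f' q →
      TermRel rel Y (.nm f (.tr p a)) (.tr q (.nm f' (.res e a)))

section Presented

variable {Gen : FinGSet G → Type w} (rel : ∀ X, Term Gen X → Term Gen X → Prop)

/-- The setoid underlying the congruence `TermRel rel`. -/
def termSetoid (X : FinGSet G) : Setoid (Term Gen X) where
  r := TermRel rel X
  iseqv := ⟨.refl, .symm, .trans⟩

/-- The values of the Tambara functor with the given generators and relations. -/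
def PresentedObj (X : FinGSet G) : Type (max (v + 1) w) := Quotient (termSetoid rel X)

instance (X : FinGSet G) : Zero (PresentedObj rel X) := ⟨Quotient.mk _ .zero⟩

instance (X : FinGSet G) : One (PresentedObj rel X) := ⟨Quotient.mk _ .one⟩

instance (X : FinGSet G) : Add (PresentedObj rel X) :=
  ⟨Quotient.map₂ Term.add fun _ _ h _ _ h' => TermRel.add_congr h h'⟩

instance (X : FinGSet G) : Mul (PresentedObj rel X) :=
  ⟨Quotient.map₂ Term.mul fun _ _ h _ _ h' => TermRel.mul_congr h h'⟩

instance (X : FinGSet G) : Neg (PresentedObj rel X) :=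
  ⟨Quotient.map Term.neg fun _ _ h => TermRel.neg_congr h⟩

instance (X : FinGSet G) : CommRing (PresentedObj rel X) where
  add_assoc := by rintro ⟨a⟩ ⟨b⟩ ⟨c⟩; exact Quotient.sound (.add_assoc a b c)
  add_comm := by rintro ⟨a⟩ ⟨b⟩; exact Quotient.sound (.add_comm a b)
  zero_add := by rintro ⟨a⟩; exact Quotient.sound (.zero_add a)
  add_zero := by rintro ⟨a⟩; exact Quotient.sound (.trans (.add_comm a .zero) (.zero_add a))
  neg_add_cancel := by rintro ⟨a⟩; exact Quotient.sound (.neg_add_cancel a)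
  mul_assoc := by rintro ⟨a⟩ ⟨b⟩ ⟨c⟩; exact Quotient.sound (.mul_assoc a b c)
  mul_comm := by rintro ⟨a⟩ ⟨b⟩; exact Quotient.sound (.mul_comm a b)
  one_mul := by rintro ⟨a⟩; exact Quotient.sound (.one_mul a)
  mul_one := by rintro ⟨a⟩; exact Quotient.sound (.trans (.mul_comm a .one) (.one_mul a))
  left_distrib := by rintro ⟨a⟩ ⟨b⟩ ⟨c⟩; exact Quotient.sound (.mul_add a b c)
  right_distrib := by
    rintro ⟨a⟩ ⟨b⟩ ⟨c⟩
    exact Quotient.sound (.trans (.mul_comm _ _) (.trans (.mul_add c a b)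
      (.add_congr (.mul_comm _ _) (.mul_comm _ _))))
  zero_mul := by
    rintro ⟨a⟩
    refine Quotient.sound ?_
    have h0 : TermRel rel X (.mul .zero a) (.mul a .zero) := .mul_comm _ _
    have h1 : TermRel rel X (.mul a .zero) ((Term.mul a .zero).add (.mul a .zero)) :=
      .trans (.mul_congr (.refl a) (.symm (.zero_add .zero))) (.mul_add a .zero .zero)
    have h2 : TermRel rel X .zero (.mul a .zero) :=
      .trans (.symm (.neg_add_cancel (.mul a .zero)))
        (.trans (.add_congr (.refl _) h1) (.trans (.symm (.add_assoc _ _ _))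
          (.trans (.add_congr (.neg_add_cancel _) (.refl _)) (.zero_add _))))
    exact .trans h0 (.symm h2)
  mul_zero := by
    rintro ⟨a⟩
    refine Quotient.sound ?_
    have h1 : TermRel rel X (.mul a .zero) ((Term.mul a .zero).add (.mul a .zero)) :=
      .trans (.mul_congr (.refl a) (.symm (.zero_add .zero))) (.mul_add a .zero .zero)
    have h2 : TermRel rel X .zero (.mul a .zero) :=
      .trans (.symm (.neg_add_cancel (.mul a .zero)))
        (.trans (.add_congr (.refl _) h1) (.trans (.symm (.add_assoc _ _ _))
          (.trans (.add_congr (.neg_add_cancel _) (.refl _)) (.zero_add _))))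
    exact .symm h2
  nsmul := nsmulRec
  zsmul := zsmulRec

/-- Restriction in a presented Tambara functor. -/
def Presented.res {X Y : FinGSet G} (f : X →[G] Y) : PresentedObj rel Y →+* PresentedObj rel X :=
  RingHom.mk'
    { toFun := Quotient.map (Term.res f) fun _ _ h => TermRel.res_congr f h
      map_one' := Quotient.sound (.res_one f)
      map_mul' := by rintro ⟨a⟩ ⟨b⟩; exact Quotient.sound (.res_mul f a b) }
    (by rintro ⟨a⟩ ⟨b⟩; exact Quotient.sound (.res_add f a b))

/-- Transfer in a presented Tambara functor. -/
def Presented.tr {X Y : FinGSet G} (f : X →[G] Y) : PresentedObj rel X →+ PresentedObj rel Y :=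
  AddMonoidHom.mk' (Quotient.map (Term.tr f) fun _ _ h => TermRel.tr_congr f h)
    (by rintro ⟨a⟩ ⟨b⟩; exact Quotient.sound (.tr_add f a b))

/-- Norm in a presented Tambara functor. -/
def Presented.nm {X Y : FinGSet G} (f : X →[G] Y) : PresentedObj rel X →* PresentedObj rel Y where
  toFun := Quotient.map (Term.nm f) fun _ _ h => TermRel.nm_congr f h
  map_one' := Quotient.sound (.nm_one f)
  map_mul' := by rintro ⟨a⟩ ⟨b⟩; exact Quotient.sound (.nm_mul f a b)

/-- The Tambara functor with the given generators and relations. -/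
def Presented : TambaraFunctor.{v, max (v + 1) w} G where
  obj := PresentedObj rel
  res := Presented.res rel
  tr := Presented.tr rel
  nm := Presented.nm rel
  res_id := by rintro X ⟨a⟩; exact Quotient.sound (.res_id a)
  res_comp := by rintro X Y Z g f ⟨a⟩; exact Quotient.sound (.res_comp g f a)
  tr_id := by rintro X ⟨a⟩; exact Quotient.sound (.tr_id a)
  tr_comp := by rintro X Y Z g f ⟨a⟩; exact Quotient.sound (.tr_comp g f a)
  nm_id := by rintro X ⟨a⟩; exact Quotient.sound (.nm_id a)
  nm_comp := by rintro X Y Z g f ⟨a⟩; exact Quotient.sound (.nm_comp g f a)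
  subsingleton_of_isEmpty X hX :=
    ⟨by rintro ⟨a⟩ ⟨b⟩; exact Quotient.sound (.of_isEmpty a b hX)⟩
  bijective_of_isDisjointUnion {X Y Z} i j hij := by
    constructor
    · rintro ⟨a⟩ ⟨b⟩ hab
      obtain ⟨h₁, h₂⟩ := Prod.mk.inj hab
      exact Quotient.sound (.of_isDisjointUnion i j a b hij (Quotient.exact h₁)
        (Quotient.exact h₂))
    · have hmac : ∀ {P X Y Z : FinGSet G} (p₁ : P →[G] X) (p₂ : P →[G] Y) (f : X →[G] Z)
          (g : Y →[G] Z), FinGSet.IsPullback p₁ p₂ f g → ∀ a : PresentedObj rel X,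
          Presented.res rel g (Presented.tr rel f a) =
            Presented.tr rel p₂ (Presented.res rel p₁ a) := by
        rintro P X Y Z p₁ p₂ f g h ⟨a⟩
        exact Quotient.sound (.res_tr p₁ p₂ f g a h)
      have hid : ∀ {X Z : FinGSet G} (f : X →[G] Z), Function.Injective f →
          ∀ a : PresentedObj rel X, Presented.res rel f (Presented.tr rel f a) = a := by
        intro X Z f hf a
        rw [hmac (MulActionHom.id G) (MulActionHom.id G) f f
          ⟨fun _ => rfl, fun x y hxy => ⟨x, ⟨rfl, hf hxy⟩, fun _ hc => hc.1⟩⟩]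
        obtain ⟨a⟩ := a
        exact Quotient.sound (.trans (.tr_id _) (.res_id a))
      have hzero : ∀ {X Y Z : FinGSet G} (f : X →[G] Z) (g : Y →[G] Z), (∀ x y, f x ≠ g y) →
          ∀ a : PresentedObj rel X, Presented.res rel g (Presented.tr rel f a) = 0 := by
        intro X Y Z f g hfg a
        let _ : MulAction G PEmpty.{v + 1} :=
          { smul := fun _ x => x, one_smul := fun _ => rfl, mul_smul := fun _ _ _ => rfl }
        rw [hmac (P := ⟨PEmpty.{v + 1}⟩) ⟨fun x => x.elim, fun _ x => x.elim⟩
          ⟨fun x => x.elim, fun _ x => x.elim⟩ f g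
          ⟨fun x => x.elim, fun x y hxy => absurd hxy (hfg x y)⟩]
        have h0 : ∀ b : PresentedObj rel (⟨PEmpty.{v + 1}⟩ : FinGSet G), b = 0 := by
          rintro ⟨b⟩
          exact Quotient.sound (.of_isEmpty b .zero ⟨fun x => x.elim⟩)
        rw [h0 (Presented.res rel _ a), map_zero]
      rintro ⟨a, b⟩
      have hne : ∀ x y, i x ≠ j y := fun x y hxy =>
        Sum.inl_ne_inr (hij.1 (show Sum.elim i j (.inl x) = Sum.elim i j (.inr y) from hxy))
      refine ⟨Presented.tr rel i a + Presented.tr rel j b, ?_⟩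
      refine Prod.ext ?_ ?_
      · change Presented.res rel i (_ + _) = a
        rw [map_add, hid i fun x x' h => Sum.inl_injective (hij.1 h),
          hzero j i fun y x h => hne x y h.symm, add_zero]
      · change Presented.res rel j (_ + _) = b
        rw [map_add, hid j fun x x' h => Sum.inr_injective (hij.1 h), hzero i j hne, zero_add]
  res_tr := by
    rintro P X Y Z p₁ p₂ f g h ⟨a⟩; exact Quotient.sound (.res_tr p₁ p₂ f g a h)
  res_nm := by
    rintro P X Y Z p₁ p₂ f g h ⟨a⟩; exact Quotient.sound (.res_nm p₁ p₂ f g a h)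
  tr_mul_res := by rintro X Y f ⟨a⟩ ⟨b⟩; exact Quotient.sound (.tr_mul_res f a b)
  nm_tr := by
    rintro A X Y E P p f e f' q h ⟨a⟩; exact Quotient.sound (.nm_tr p f e f' q a h)

/-- The value of a formal expression in a Tambara functor `T`, given values of the generators. -/
def Term.eval {T : TambaraFunctor.{v, u} G} (val : ∀ X, Gen X → T.obj X) :
    ∀ {X : FinGSet G}, Term Gen X → T.obj X
  | X, .gen x => val X x
  | _, .zero => 0
  | _, .one => 1
  | _, .add a b => a.eval val + b.eval val
  | _, .mul a b => a.eval val * b.eval val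
  | _, .neg a => -a.eval val
  | _, .res f a => T.res f (a.eval val)
  | _, .tr f a => T.tr f (a.eval val)
  | _, .nm f a => T.nm f (a.eval val)

theorem TermRel.eval_eq {rel : ∀ X, Term Gen X → Term Gen X → Prop} {T : TambaraFunctor.{v, u} G}
    (val : ∀ X, Gen X → T.obj X)
    (hval : ∀ X (a b : Term Gen X), rel X a b → a.eval val = b.eval val)
    {X : FinGSet G} {a b : Term Gen X} (h : TermRel rel X a b) : a.eval val = b.eval val := by
  induction h with
  | of h => exact hval _ _ _ h
  | refl a => rfl
  | symm _ ih => exact ih.symm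
  | trans _ _ ih₁ ih₂ => exact ih₁.trans ih₂
  | add_congr _ _ ih₁ ih₂ => simp only [Term.eval, ih₁, ih₂]
  | mul_congr _ _ ih₁ ih₂ => simp only [Term.eval, ih₁, ih₂]
  | neg_congr _ ih => simp only [Term.eval, ih]
  | res_congr f _ ih => simp only [Term.eval, ih]
  | tr_congr f _ ih => simp only [Term.eval, ih]
  | nm_congr f _ ih => simp only [Term.eval, ih]
  | add_assoc => exact _root_.add_assoc _ _ _
  | add_comm => exact _root_.add_comm _ _
  | zero_add => exact _root_.zero_add _
  | neg_add_cancel => exact _root_.neg_add_cancel _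
  | mul_assoc => exact _root_.mul_assoc _ _ _
  | mul_comm => exact _root_.mul_comm _ _
  | one_mul => exact _root_.one_mul _
  | mul_add => exact _root_.mul_add _ _ _
  | res_one f => exact map_one _
  | res_add f => exact map_add _ _ _
  | res_mul f => exact map_mul _ _ _
  | tr_add f => exact map_add _ _ _
  | nm_one f => exact map_one _
  | nm_mul f => exact map_mul _ _ _
  | res_id a => exact T.res_id _
  | res_comp g f a => exact T.res_comp g f _
  | tr_id a => exact T.tr_id _
  | tr_comp g f a => exact T.tr_comp g f _
  | nm_id a => exact T.nm_id _
  | nm_comp g f a => exact T.nm_comp g f _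
  | of_isEmpty a b h => exact (T.subsingleton_of_isEmpty _ h).elim _ _
  | of_isDisjointUnion i j a b h _ _ ih₁ ih₂ =>
    exact (T.bijective_of_isDisjointUnion i j h).1 (Prod.ext ih₁ ih₂)
  | res_tr p₁ p₂ f g a h => exact T.res_tr p₁ p₂ f g h _
  | res_nm p₁ p₂ f g a h => exact T.res_nm p₁ p₂ f g h _
  | tr_mul_res f a b => exact T.tr_mul_res f _ _
  | nm_tr p f e f' q a h => exact T.nm_tr p f e f' q h _

/-- The morphism out of a presented Tambara functor determined by values of the generators
which satisfy the relations. -/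
def Presented.lift {rel : ∀ X, Term Gen X → Term Gen X → Prop} {T : TambaraFunctor.{v, u} G}
    (val : ∀ X, Gen X → T.obj X)
    (hval : ∀ X (a b : Term Gen X), rel X a b → a.eval val = b.eval val) :
    Hom (Presented rel) T where
  app X := RingHom.mk'
    { toFun := Quotient.lift (Term.eval val) fun _ _ h => TermRel.eval_eq val hval h
      map_one' := rfl
      map_mul' := by rintro ⟨a⟩ ⟨b⟩; rfl }
    (by rintro ⟨a⟩ ⟨b⟩; rfl)
  app_res := by rintro X Y f ⟨a⟩; rfl
  app_tr := by rintro X Y f ⟨a⟩; rfl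
  app_nm := by rintro X Y f ⟨a⟩; rfl

end Presented

/-! ## The box product of algebras, ideals, and genuine Kähler differentials -/

section BoxAlg

variable {k : TambaraFunctor.{v, u} G} {R : TambaraFunctor.{v, u₁} G}
  {S : TambaraFunctor.{v, u₂} G} (φ : Hom k R) (ψ : Hom k S)

/-- The relations among the symbols `a ⊠ 1` (`a ∈ R`) and `1 ⊠ b` (`b ∈ S`) in `R ⊠_k S`:
both maps are morphisms of Tambara functors, and they agree on `k`. -/
inductive BoxAlgRel (φ : Hom k R) (ψ : Hom k S) :
    ∀ X, Term (fun X => R.obj X ⊕ S.obj X) X → Term (fun X => R.obj X ⊕ S.obj X) X → Prop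
  | inl_one {X} : BoxAlgRel φ ψ X (.gen (.inl 1)) .one
  | inl_add {X} (a b : R.obj X) : BoxAlgRel φ ψ X (.gen (.inl (a + b)))
      (.add (.gen (.inl a)) (.gen (.inl b)))
  | inl_mul {X} (a b : R.obj X) : BoxAlgRel φ ψ X (.gen (.inl (a * b)))
      (.mul (.gen (.inl a)) (.gen (.inl b)))
  | inl_res {X Y : FinGSet G} (f : X →[G] Y) (a : R.obj Y) :
      BoxAlgRel φ ψ X (.gen (.inl (R.res f a))) (.res f (.gen (.inl a)))
  | inl_tr {X Y : FinGSet G} (f : X →[G] Y) (a : R.obj X) :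
      BoxAlgRel φ ψ Y (.gen (.inl (R.tr f a))) (.tr f (.gen (.inl a)))
  | inl_nm {X Y : FinGSet G} (f : X →[G] Y) (a : R.obj X) :
      BoxAlgRel φ ψ Y (.gen (.inl (R.nm f a))) (.nm f (.gen (.inl a)))
  | inr_one {X} : BoxAlgRel φ ψ X (.gen (.inr 1)) .one
  | inr_add {X} (a b : S.obj X) : BoxAlgRel φ ψ X (.gen (.inr (a + b)))
      (.add (.gen (.inr a)) (.gen (.inr b)))
  | inr_mul {X} (a b : S.obj X) : BoxAlgRel φ ψ X (.gen (.inr (a * b)))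
      (.mul (.gen (.inr a)) (.gen (.inr b)))
  | inr_res {X Y : FinGSet G} (f : X →[G] Y) (a : S.obj Y) :
      BoxAlgRel φ ψ X (.gen (.inr (S.res f a))) (.res f (.gen (.inr a)))
  | inr_tr {X Y : FinGSet G} (f : X →[G] Y) (a : S.obj X) :
      BoxAlgRel φ ψ Y (.gen (.inr (S.tr f a))) (.tr f (.gen (.inr a)))
  | inr_nm {X Y : FinGSet G} (f : X →[G] Y) (a : S.obj X) :
      BoxAlgRel φ ψ Y (.gen (.inr (S.nm f a))) (.nm f (.gen (.inr a)))
  | glue {X} (c : k.obj X) :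
      BoxAlgRel φ ψ X (.gen (.inl (φ.app X c))) (.gen (.inr (ψ.app X c)))

/-- The box product `R ⊠_k S` of `k`-algebras, as a Tambara functor. As is standard, it is the
coproduct of `R` and `S` in `k`-algebras, i.e. the pushout of `R ← k → S` in Tambara functors. -/
def boxAlg : TambaraFunctor.{v, max (v + 1) u₁ u₂} G :=
  Presented.{v, max u₁ u₂} (BoxAlgRel φ ψ)

/-- The morphism `R ⊠_k S → T` determined by two morphisms which agree on `k`. -/
def boxAlgLift {T : TambaraFunctor.{v, w} G} (f : Hom R T) (g : Hom S T)
    (h : ∀ X (c : k.obj X), f.app X (φ.app X c) = g.app X (ψ.app X c)) :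
    Hom (boxAlg φ ψ) T :=
  Presented.lift (fun X => Sum.elim (f.app X) (g.app X)) <| by
    intro _ a b hab
    cases hab with
    | inl_one => exact map_one _
    | inl_add => exact map_add _ _ _
    | inl_mul => exact map_mul _ _ _
    | inl_res => exact f.app_res _ _
    | inl_tr => exact f.app_tr _ _
    | inl_nm => exact f.app_nm _ _
    | inr_one => exact map_one _
    | inr_add => exact map_add _ _ _
    | inr_mul => exact map_mul _ _ _
    | inr_res => exact g.app_res _ _
    | inr_tr => exact g.app_tr _ _
    | inr_nm => exact g.app_nm _ _
    | glue c => exact h _ c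

/-- The identity morphism. -/
def Hom.id (R : TambaraFunctor.{v, u} G) : Hom R R where
  app X := RingHom.id _
  app_res _ _ := rfl
  app_tr _ _ := rfl
  app_nm _ _ := rfl

/-- The multiplication `R ⊠_k R → R`. -/
def mulHom : Hom (boxAlg φ φ) R :=
  boxAlgLift φ φ (Hom.id R) (Hom.id R) fun _ _ => rfl

end BoxAlg

/-- A Tambara ideal: levelwise ideals, closed under restrictions, transfers, and norms. Norms
along surjective maps preserve membership; in general `nm f a` is congruent to `nm f 0`. -/
structure TambaraIdeal (T : TambaraFunctor.{v, u} G) where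
  carrier : ∀ X, Ideal (T.obj X)
  res_mem : ∀ {X Y : FinGSet G} (f : X →[G] Y) {a : T.obj Y},
    a ∈ carrier Y → T.res f a ∈ carrier X
  tr_mem : ∀ {X Y : FinGSet G} (f : X →[G] Y) {a : T.obj X},
    a ∈ carrier X → T.tr f a ∈ carrier Y
  nm_mem : ∀ {X Y : FinGSet G} (f : X →[G] Y) {a : T.obj X},
    a ∈ carrier X → T.nm f a - T.nm f 0 ∈ carrier Y

/-- The kernel of a morphism of Tambara functors. -/
def Hom.ker {S : TambaraFunctor.{v, u₁} G} {T : TambaraFunctor.{v, u₂} G} (f : Hom S T) :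
    TambaraIdeal S where
  carrier X := RingHom.ker (f.app X)
  res_mem g a ha := by rw [RingHom.mem_ker] at ha ⊢; rw [f.app_res, ha, map_zero]
  tr_mem g a ha := by rw [RingHom.mem_ker] at ha ⊢; rw [f.app_tr, ha, map_zero]
  nm_mem g a ha := by
    rw [RingHom.mem_ker] at ha ⊢
    rw [map_sub, f.app_nm, f.app_nm, ha, map_zero (f.app _), sub_self]

section Kahler

variable [Finite G]

/-- The ideal `J` contains all products of two elements of `I`, and all norms of elements of `I`
along non-injective maps `G/K → G/H` (equivalently, along all maps `G/K → G/H` for which `K` is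
conjugate to a proper subgroup of `H`). -/
def TambaraIdeal.ContainsNontrivialNorms {T : TambaraFunctor.{v, u} G} (I J : TambaraIdeal T) :
    Prop :=
  (∀ X, ∀ a ∈ I.carrier X, ∀ b ∈ I.carrier X, a * b ∈ J.carrier X) ∧
  ∀ (K H : Subgroup G) (f : FinGSet.orbit K →[G] FinGSet.orbit H), ¬ Function.Injective f →
    ∀ a ∈ I.carrier (FinGSet.orbit K), T.nm f a ∈ J.carrier (FinGSet.orbit H)

/-- The ideal `I^{>1}` generated by all nontrivial norms, including products, of elements
of `I`. -/
def TambaraIdeal.gtOne {T : TambaraFunctor.{v, u} G} (I : TambaraIdeal T) : TambaraIdeal T where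
  carrier X := ⨅ J : {J : TambaraIdeal T // I.ContainsNontrivialNorms J}, J.1.carrier X
  res_mem f a ha := by
    rw [Submodule.mem_iInf] at ha ⊢
    exact fun J => J.1.res_mem f (ha J)
  tr_mem f a ha := by
    rw [Submodule.mem_iInf] at ha ⊢
    exact fun J => J.1.tr_mem f (ha J)
  nm_mem f a ha := by
    rw [Submodule.mem_iInf] at ha ⊢
    exact fun J => J.1.nm_mem f (ha J)

/-- The value at `X` of the genuine Kähler differentials `Ω^{1,Tamb}_{R/k} = I / I^{>1}`, where
`I` is the kernel of the multiplication `R ⊠_k R → R`. -/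
abbrev KahlerDifferentials {k : TambaraFunctor.{v, u₁} G} {R : TambaraFunctor.{v, u₂} G}
    (φ : Hom k R) (X : FinGSet G) : Type (max (v + 1) u₂) :=
  ((mulHom φ).ker.carrier X) ⧸
    Submodule.comap ((mulHom φ).ker.carrier X).subtype ((mulHom φ).ker.gtOne.carrier X)

/-- A morphism `k → R` of Tambara functors is formally étale if `Ω^{1,Tamb}_{R/k} = 0` and `R` is
a flat `k`-module. -/
def Hom.FormallyEtale {k : TambaraFunctor.{v, u₁} G} {R : TambaraFunctor.{v, u₂} G}
    (φ : Hom k R) : Prop :=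
  (∀ X, Subsingleton (KahlerDifferentials φ X)) ∧ φ.toMod.IsFlat

end Kahler

/-! ## Finite presentation -/

/-- The `k`-algebra `F`, with elements `x i ∈ F(X i)`, is the free polynomial `k`-algebra
`k[x_i]` on generators `x i` in levels `X i`: it represents `S ↦ ∏ i, S(X i)` on `k`-algebras. -/
def IsFreePolynomial {k : TambaraFunctor.{v, u} G} {F : TambaraFunctor.{v, w} G} (φ : Hom k F)
    {I : Type} (X : I → FinGSet G) (x : ∀ i, F.obj (X i)) : Prop :=
  ∀ (S : TambaraFunctor.{v, w} G) (ψ : Hom k S) (s : ∀ i, S.obj (X i)),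
    ∃! h : Hom F S, h.comp φ = ψ ∧ ∀ i, h.app (X i) (x i) = s i

/-- The `k`-algebra `R` is finitely presented: it is a coequalizer in `k`-algebras of two maps
between free polynomial `k`-algebras on finitely many generators. -/
def Hom.FinitelyPresented {k : TambaraFunctor.{v, u} G} {R : TambaraFunctor.{v, u} G}
    (φ : Hom k R) : Prop :=
  ∃ (I J : Type) (_ : Finite I) (_ : Finite J) (X : I → FinGSet G) (Y : J → FinGSet G)
    (F₁ F₂ : TambaraFunctor.{v, max (v + 1) u} G) (φ₁ : Hom k F₁) (φ₂ : Hom k F₂)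
    (x : ∀ i, F₁.obj (X i)) (y : ∀ j, F₂.obj (Y j)) (f g : Hom F₁ F₂) (q : Hom F₂ R),
    IsFreePolynomial φ₁ X x ∧ IsFreePolynomial φ₂ Y y ∧
    f.comp φ₁ = φ₂ ∧ g.comp φ₁ = φ₂ ∧ q.comp φ₂ = φ ∧ q.comp f = q.comp g ∧
    ∀ (S : TambaraFunctor.{v, max (v + 1) u} G) (ψ : Hom k S) (h : Hom F₂ S),
      h.comp φ₂ = ψ → h.comp f = h.comp g → ∃! r : Hom R S, r.comp φ = ψ ∧ r.comp q = h

/-- A morphism of Tambara functors is étale if it is formally étale and finitely presented. -/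
def Hom.Etale [Finite G] {k : TambaraFunctor.{v, u} G} {R : TambaraFunctor.{v, u} G}
    (φ : Hom k R) : Prop :=
  φ.FormallyEtale ∧ φ.FinitelyPresented

end TambaraFunctor

namespace FinGSet

variable {G : Type v} [Group G]

noncomputable instance (X : FinGSet G) : Fintype X := Fintype.ofFinite X

/-- The finite `G`-set given by an invariant subset. -/
def sub {X : FinGSet G} (U : SubMulAction G X) : FinGSet G where
  carrier := U

/-- The inclusion of an invariant subset. -/
def incl {X : FinGSet G} (U : SubMulAction G X) : sub U →[G] X where
  toFun := Subtype.val
  map_smul' _ _ := rfl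

/-- The inclusion of an invariant subset in a larger one. -/
def inclOfLE {X : FinGSet G} {U V : SubMulAction G X} (h : U ≤ V) : sub U →[G] sub V where
  toFun x := ⟨x.1, h x.2⟩
  map_smul' _ _ := rfl

/-- The disjoint union of copies of `Z` indexed by `S`. -/
def copies (S : Type v) [Finite S] (Z : FinGSet G) : FinGSet G where
  carrier := S × Z
  action :=
    { smul g x := (x.1, g • x.2)
      one_smul x := Prod.ext rfl (one_smul G x.2)
      mul_smul g h x := Prod.ext rfl (mul_smul g h x.2) }

/-- The inclusion of the copy of `Z` indexed by `s`. -/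
def copiesIncl {S : Type v} [Finite S] (Z : FinGSet G) (s : S) : Z →[G] copies S Z where
  toFun z := (s, z)
  map_smul' _ _ := rfl

/-- The fold map. -/
def copiesFold (S : Type v) [Finite S] (Z : FinGSet G) : copies S Z →[G] Z where
  toFun x := x.2
  map_smul' _ _ := rfl

/-- The empty `G`-set. -/
def empty (G : Type v) [Group G] : FinGSet G where
  carrier := PEmpty.{v + 1}
  action :=
    { smul := fun _ x => x
      one_smul := fun _ => rfl
      mul_smul := fun _ _ _ => rfl }

instance : IsEmpty (empty G) := inferInstanceAs (IsEmpty PEmpty)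

/-- The map out of the empty `G`-set. -/
def emptyElim (X : FinGSet G) : empty G →[G] X where
  toFun x := isEmptyElim x
  map_smul' _ x := isEmptyElim x

theorem isPullback_of_injective {X Z : FinGSet G} (i : X →[G] Z) (hi : Function.Injective i) :
    IsPullback (MulActionHom.id G : X →[G] X) (MulActionHom.id G : X →[G] X) i i :=
  ⟨fun _ => rfl, fun x _ hxy => ⟨x, ⟨rfl, hi hxy⟩, fun _ hc => hc.1⟩⟩

theorem isPullback_of_disjoint {X Y Z : FinGSet G} (i : X →[G] Z) (j : Y →[G] Z)
    (hij : ∀ x y, i x ≠ j y) : IsPullback (emptyElim X) (emptyElim Y) i j :=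
  ⟨fun x => isEmptyElim x, fun x y hxy => absurd hxy (hij x y)⟩

theorem isDisjointUnion_empty {X Z : FinGSet G} (i : X →[G] Z) (hi : Function.Bijective i) :
    IsDisjointUnion i (emptyElim Z) := by
  constructor
  · rintro (x | x) (y | y) h
    · exact congrArg _ (hi.1 h)
    · exact isEmptyElim y
    · exact isEmptyElim x
    · exact isEmptyElim x
  · intro z
    obtain ⟨x, rfl⟩ := hi.2 z
    exact ⟨.inl x, rfl⟩

variable [Finite G]

/-- The equivariant map `G/e → X` through the point `x`. -/
def point {X : FinGSet G} (x : X) : orbit (⊥ : Subgroup G) →[G] X where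
  toFun q := Quotient.liftOn' q (fun g => g • x) fun a b h => by
    rw [QuotientGroup.leftRel_apply, Subgroup.mem_bot, inv_mul_eq_one] at h
    exact congrArg (· • x) h
  map_smul' := by
    rintro g ⟨a⟩
    exact mul_smul g a x

/-- The base point of `G/e`. -/
def base (G : Type v) [Group G] [Finite G] : orbit (⊥ : Subgroup G) :=
  QuotientGroup.mk (s := (⊥ : Subgroup G)) (1 : G)

theorem point_base {X : FinGSet G} (x : X) : point x (base G) = x := one_smul G x

theorem exists_smul_base (q : orbit (⊥ : Subgroup G)) : ∃ g : G, g • base G = q := by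
  obtain ⟨a, rfl⟩ := QuotientGroup.mk_surjective (s := (⊥ : Subgroup G)) q
  exact ⟨a, congrArg _ (mul_one a)⟩

theorem hom_ext_base {X : FinGSet G} {f g : orbit (⊥ : Subgroup G) →[G] X}
    (h : f (base G) = g (base G)) : f = g := by
  ext q
  obtain ⟨a, rfl⟩ := exists_smul_base q
  rw [map_smul, map_smul, h]

theorem comp_point {X Y : FinGSet G} (f : X →[G] Y) (x : X) :
    (f.comp (point x) : orbit (⊥ : Subgroup G) →[G] Y) = point (f x) :=
  hom_ext_base (by rw [MulActionHom.comp_apply, point_base, point_base])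

theorem apply_point {X Y : FinGSet G} (f : X →[G] Y) (x : X) (q : orbit (⊥ : Subgroup G)) :
    f (point x q) = point (f x) q := by
  rw [← comp_point, MulActionHom.comp_apply]

theorem point_base_eq_id : point (base G) = MulActionHom.id G :=
  hom_ext_base (by rw [point_base]; rfl)

/-- The projection to `X` of the pullback of `f : X → Y` along `point y`. -/
def fibrePoint {X Y : FinGSet G} (f : X →[G] Y) (y : Y) :
    copies {x : X // f x = y} (orbit (⊥ : Subgroup G)) →[G] X where
  toFun c := point c.1.1 c.2
  map_smul' g c := map_smul (point c.1.1) g c.2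

theorem isPullback_fibrePoint {X Y : FinGSet G} (f : X →[G] Y) (y : Y) :
    IsPullback (fibrePoint f y) (copiesFold {x : X // f x = y} _) f (point y) := by
  constructor
  · rintro ⟨⟨x, rfl⟩, q⟩
    exact apply_point f x q
  · intro x q hx
    obtain ⟨g, rfl⟩ := exists_smul_base q
    rw [map_smul, point_base] at hx
    refine ⟨(⟨g⁻¹ • x, ?_⟩, g • base G), ⟨?_, rfl⟩, ?_⟩
    · rw [map_smul, hx, inv_smul_smul]
    · change point (g⁻¹ • x) (g • base G) = x
      rw [map_smul, point_base, smul_inv_smul]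
    · rintro ⟨⟨z, hz⟩, q⟩ ⟨h₁, h₂⟩
      change q = g • base G at h₂
      subst h₂
      change point z (g • base G) = x at h₁
      rw [map_smul, point_base] at h₁
      refine Prod.ext (Subtype.ext ?_) rfl
      change z = g⁻¹ • x
      rw [← h₁, inv_smul_smul]

theorem fibrePoint_comp_copiesIncl {X Y : FinGSet G} (f : X →[G] Y) (y : Y)
    (x : {x : X // f x = y}) :
    ((fibrePoint f y).comp (copiesIncl _ x) : orbit (⊥ : Subgroup G) →[G] X) = point x.1 := by
  ext q
  rfl

end FinGSet

namespace TambaraFunctor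

open FinGSet

variable {G : Type v} [Group G] {k : TambaraFunctor.{v, u} G}

namespace Mod

variable (M : Mod.{v, u, w} k)

theorem eq_zero_of_isEmpty {X : FinGSet G} (hX : IsEmpty X) (m : M.obj X) : m = 0 :=
  (M.subsingleton_of_isEmpty X hX).elim _ _

theorem res_tr_of_injective {X Z : FinGSet G} (i : X →[G] Z) (hi : Function.Injective i)
    (m : M.obj X) : M.res i (M.tr i m) = m := by
  rw [M.res_tr _ _ _ _ (isPullback_of_injective i hi), M.res_id, M.tr_id]

theorem res_tr_of_disjoint {X Y Z : FinGSet G} (i : X →[G] Z) (j : Y →[G] Z)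
    (hij : ∀ x y, i x ≠ j y) (m : M.obj X) : M.res j (M.tr i m) = 0 := by
  rw [M.res_tr _ _ _ _ (isPullback_of_disjoint i j hij),
    M.eq_zero_of_isEmpty inferInstance (M.res _ m), map_zero]

theorem tr_res_add_tr_res {X Y Z : FinGSet G} (i : X →[G] Z) (j : Y →[G] Z)
    (h : IsDisjointUnion i j) (m : M.obj Z) : M.tr i (M.res i m) + M.tr j (M.res j m) = m := by
  have hne : ∀ x y, i x ≠ j y := fun x y hxy =>
    Sum.inl_ne_inr (h.1 (show Sum.elim i j (.inl x) = Sum.elim i j (.inr y) from hxy))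
  apply (M.bijective_of_isDisjointUnion i j h).1
  refine Prod.ext ?_ ?_
  · simp only [map_add]
    rw [M.res_tr_of_injective i fun x x' h' => Sum.inl_injective (h.1 h'),
      M.res_tr_of_disjoint j i fun y x h => hne x y h.symm, add_zero]
  · simp only [map_add]
    rw [M.res_tr_of_injective j fun x x' h' => Sum.inr_injective (h.1 h'),
      M.res_tr_of_disjoint i j hne, zero_add]

theorem tr_res_of_bijective {X Z : FinGSet G} (i : X →[G] Z) (hi : Function.Bijective i)
    (m : M.obj Z) : M.tr i (M.res i m) = m := by
  have h := M.tr_res_add_tr_res i _ (isDisjointUnion_empty i hi) m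
  rwa [M.eq_zero_of_isEmpty inferInstance (M.res (emptyElim Z) m), map_zero, add_zero] at h

/-- Membership in a family of subgroups closed under restrictions and transfers is local. -/
theorem mem_of_cover (N : ∀ X, AddSubgroup (M.obj X))
    (hres : ∀ {X Y : FinGSet G} (f : X →[G] Y), ∀ m ∈ N Y, M.res f m ∈ N X)
    (htr : ∀ {X Y : FinGSet G} (f : X →[G] Y), ∀ m ∈ N X, M.tr f m ∈ N Y)
    {Z : FinGSet G} (m : M.obj Z)
    (h : ∀ z : Z, ∃ (Y : FinGSet G) (i : Y →[G] Z), Function.Injective i ∧ z ∈ Set.range i ∧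
      M.res i m ∈ N Y) : m ∈ N Z := by
  have hmono : ∀ {U V : SubMulAction G Z}, U ≤ V → M.res (incl V) m ∈ N _ →
      M.res (incl U) m ∈ N _ := by
    intro U V hUV hV
    have hc : (incl U : sub U →[G] Z) = (incl V).comp (inclOfLE hUV) := rfl
    rw [hc, M.res_comp]
    exact hres _ _ hV
  have hsup : ∀ {U V : SubMulAction G Z}, M.res (incl U) m ∈ N _ → M.res (incl V) m ∈ N _ →
      M.res (incl (U ⊔ V)) m ∈ N _ := by
    intro U V hU hV
    have hle : V ⊓ Uᶜ ≤ U ⊔ V := inf_le_left.trans le_sup_right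
    have hd : IsDisjointUnion (inclOfLE (le_sup_left : U ≤ U ⊔ V)) (inclOfLE hle) := by
      constructor
      · rintro (x | x) (y | y) hxy
        · have h' := congrArg (fun a : sub (U ⊔ V) => a.1) hxy
          exact congrArg Sum.inl (Subtype.ext h')
        · exact absurd ((congrArg (fun a : sub _ => a.1) hxy : x.1 = y.1) ▸ x.2) y.2.2
        · exact absurd ((congrArg (fun a : sub _ => a.1) hxy : x.1 = y.1).symm ▸ y.2) x.2.2
        · have h' := congrArg (fun a : sub (U ⊔ V) => a.1) hxy
          exact congrArg Sum.inr (Subtype.ext h')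
      · rintro ⟨z, hz⟩
        by_cases hzU : z ∈ U
        · exact ⟨.inl ⟨z, hzU⟩, rfl⟩
        · exact ⟨.inr ⟨z, hz.resolve_left hzU, hzU⟩, rfl⟩
    rw [← M.tr_res_add_tr_res _ _ hd (M.res _ m), ← M.res_comp, ← M.res_comp]
    exact add_mem (htr _ _ hU) (htr _ _ (hmono inf_le_left hV))
  choose Y i hi hz hm using h
  have hloc : ∀ z : Z, ∃ U : SubMulAction G Z, z ∈ U ∧ M.res (incl U) m ∈ N _ := by
    intro z
    let U : SubMulAction G Z :=
      { carrier := Set.range (i z)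
        smul_mem' := by
          rintro g _ ⟨y, rfl⟩
          exact ⟨g • y, map_smul _ _ _⟩ }
    let e : Y z →[G] sub U :=
      { toFun := fun y => ⟨i z y, y, rfl⟩
        map_smul' := fun g y => Subtype.ext (map_smul (i z) g y) }
    have he : Function.Bijective e :=
      ⟨fun y y' h => hi z (congrArg Subtype.val h), fun ⟨_, y, hy⟩ => ⟨y, Subtype.ext hy⟩⟩
    refine ⟨U, hz z, ?_⟩
    rw [← M.tr_res_of_bijective e he (M.res (incl U) m), ← M.res_comp]
    exact htr _ _ (hm z)
  choose U hzU hU using hloc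
  have hall : ∀ s : Set Z, s.Finite → ∃ V : SubMulAction G Z, s ⊆ V ∧ M.res (incl V) m ∈ N _ := by
    intro s hs
    induction s, hs using Set.Finite.induction_on with
    | empty =>
      refine ⟨⊥, Set.empty_subset _, ?_⟩
      rw [M.eq_zero_of_isEmpty ⟨fun x : (⊥ : SubMulAction G Z) => x.2⟩ (M.res _ m)]
      exact zero_mem _
    | @insert z s _ _ ih =>
      obtain ⟨V, hsV, hV⟩ := ih
      refine ⟨U z ⊔ V, Set.insert_subset (Or.inl (hzU z)) fun x hx => Or.inr (hsV hx),
        hsup (hU z) hV⟩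
  obtain ⟨V, hV, hmV⟩ := hall Set.univ (Set.toFinite _)
  rw [← M.tr_res_of_bijective (incl V) ⟨Subtype.val_injective, fun z => ⟨⟨z, hV trivial⟩, rfl⟩⟩ m]
  exact htr _ _ hmV

theorem ext_of_cover {Z : FinGSet G} (m m' : M.obj Z)
    (h : ∀ z : Z, ∃ (Y : FinGSet G) (i : Y →[G] Z), Function.Injective i ∧ z ∈ Set.range i ∧
      M.res i m = M.res i m') : m = m' := by
  rw [← sub_eq_zero, ← AddSubgroup.mem_bot]
  refine M.mem_of_cover (fun _ => ⊥) ?_ ?_ _ fun z => ?_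
  · rintro X Y f _ rfl
    exact map_zero _
  · rintro X Y f _ rfl
    exact map_zero _
  · obtain ⟨Y, i, hi, hz, h⟩ := h z
    exact ⟨Y, i, hi, hz, by rw [map_sub, h, sub_self]; exact zero_mem _⟩

theorem ext_copies {S : Type v} [Finite S] {Z : FinGSet G} (m m' : M.obj (copies S Z))
    (h : ∀ s, M.res (copiesIncl Z s) m = M.res (copiesIncl Z s) m') : m = m' :=
  M.ext_of_cover m m' fun z => ⟨Z, copiesIncl Z z.1, fun _ _ h => congrArg Prod.snd h,
    ⟨z.2, rfl⟩, h z.1⟩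

theorem sum_tr_copiesIncl {S : Type v} [Fintype S] {Z : FinGSet G} (m : M.obj (copies S Z)) :
    ∑ s, M.tr (copiesIncl Z s) (M.res (copiesIncl Z s) m) = m := by
  refine M.ext_copies _ _ fun s => ?_
  rw [map_sum, Fintype.sum_eq_single s]
  · exact M.res_tr_of_injective _ (fun _ _ h => congrArg Prod.snd h) _
  · exact fun t ht => M.res_tr_of_disjoint _ _ (fun _ _ h => ht (congrArg Prod.fst h)) _

open Classical in
/-- The double coset formula for the restriction of a transfer to a point. -/
theorem res_point_tr [Finite G] {X Y : FinGSet G} (f : X →[G] Y) (m : M.obj X) (y : Y) :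
    M.res (point y) (M.tr f m) = ∑ x with f x = y, M.res (point x) m := by
  rw [M.res_tr _ _ _ _ (isPullback_fibrePoint f y), ← M.sum_tr_copiesIncl (M.res _ m), map_sum,
    ← Finset.sum_subtype_of_mem (p := fun x => f x = y) (s := {x | f x = y})
      (fun x => M.res (point x) m) (fun x hx => by simpa using hx)]
  refine Finset.sum_congr (by ext x; simpa using x.2) fun x _ => ?_
  rw [← M.tr_comp, ← M.res_comp, fibrePoint_comp_copiesIncl]
  exact M.tr_id _

end Mod

variable (T : TambaraFunctor.{v, u} G)

theorem res_nm_of_injective {X Z : FinGSet G} (i : X →[G] Z) (hi : Function.Injective i)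
    (a : T.obj X) : T.res i (T.nm i a) = a := by
  rw [T.res_nm _ _ _ _ (isPullback_of_injective i hi), T.res_id, T.nm_id]

theorem res_nm_of_disjoint {X Y Z : FinGSet G} (i : X →[G] Z) (j : Y →[G] Z)
    (hij : ∀ x y, i x ≠ j y) (a : T.obj X) : T.res j (T.nm i a) = 1 := by
  rw [T.res_nm _ _ _ _ (isPullback_of_disjoint i j hij),
    (T.subsingleton_of_isEmpty (empty G) inferInstance).elim (T.res _ a) 1, map_one]

theorem prod_nm_copiesIncl {S : Type v} [Fintype S] {Z : FinGSet G} (a : T.obj (copies S Z)) :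
    ∏ s, T.nm (copiesIncl Z s) (T.res (copiesIncl Z s) a) = a := by
  refine (Hom.id T).toMod.ext_copies _ _ fun s => ?_
  change T.res _ _ = T.res _ _
  rw [map_prod, Fintype.prod_eq_single s]
  · exact T.res_nm_of_injective _ (fun _ _ h => congrArg Prod.snd h) _
  · exact fun t ht => T.res_nm_of_disjoint _ _ (fun _ _ h => ht (congrArg Prod.fst h)) _

variable [Finite G]

open Classical in
/-- The double coset formula for the restriction of a transfer to a point. -/
theorem res_point_tr {X Y : FinGSet G} (f : X →[G] Y) (a : T.obj X) (y : Y) :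
    T.res (point y) (T.tr f a) = ∑ x with f x = y, T.res (point x) a :=
  (Hom.id T).toMod.res_point_tr f a y

open Classical in
/-- The double coset formula for the restriction of a norm to a point. -/
theorem res_point_nm {X Y : FinGSet G} (f : X →[G] Y) (a : T.obj X) (y : Y) :
    T.res (point y) (T.nm f a) = ∏ x with f x = y, T.res (point x) a := by
  rw [T.res_nm _ _ _ _ (isPullback_fibrePoint f y), ← T.prod_nm_copiesIncl (T.res _ a), map_prod,
    ← Finset.prod_subtype_of_mem (p := fun x => f x = y) (s := {x | f x = y})
      (fun x => T.res (point x) a) (fun x hx => by simpa using hx)]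
  refine Finset.prod_congr (by ext x; simpa using x.2) fun x _ => ?_
  rw [← T.nm_comp, ← T.res_comp, fibrePoint_comp_copiesIncl]
  exact T.nm_id _

end TambaraFunctor

section Fibre

variable {C : Type*} [CommMonoid C] {X Y Z : Type*} [Fintype X]

open Classical in
/-- Multiplication (in the additive version, summation) of a function along the fibres of a map. -/
@[to_additive]
noncomputable def fibreProd (f : X → Y) : (X → C) →* (Y → C) where
  toFun a y := ∏ x with f x = y, a x
  map_one' := funext fun _ => Finset.prod_const_one
  map_mul' _ _ := funext fun _ => Finset.prod_mul_distrib

open Classical in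
@[to_additive]
theorem fibreProd_apply (f : X → Y) (a : X → C) (y : Y) :
    fibreProd f a y = ∏ x with f x = y, a x := rfl

@[to_additive]
theorem fibreProd_apply_subtype (f : X → Y) (a : X → C) (y : Y)
    [Fintype {x // f x = y}] :
    fibreProd f a y = ∏ x : {x // f x = y}, a x := by
  classical
  rw [fibreProd_apply]
  exact Finset.prod_subtype _ (fun x => by simp) a

@[to_additive]
theorem fibreProd_id (a : X → C) :
    fibreProd id a = a := by
  classical
  funext x
  rw [fibreProd_apply, Finset.prod_eq_single x]
  · exact fun y hy hyx => absurd (Finset.mem_filter.1 hy).2 hyx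
  · exact fun h => absurd (by simp) h

@[to_additive]
theorem fibreProd_comp [Fintype Y] (g : Y → Z) (f : X → Y) (a : X → C) :
    fibreProd (g ∘ f) a = fibreProd g (fibreProd f a) := by
  classical
  funext z
  simp only [fibreProd_apply]
  rw [← Finset.prod_fiberwise_of_maps_to (s := {x | (g ∘ f) x = z})
    (t := {y | g y = z}) (g := f) (by simp)]
  refine Finset.prod_congr rfl fun y hy => ?_
  rw [Finset.filter_filter]
  refine Finset.prod_congr ?_ fun _ _ => rfl
  ext x
  simp only [Finset.mem_filter, Finset.mem_univ, true_and, Function.comp_apply] at hy ⊢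
  exact ⟨fun h => h.2, fun h => ⟨h ▸ hy, h⟩⟩

@[to_additive]
theorem fibreProd_pullback {P : Type*} [Fintype P] (p₁ : P → X) (p₂ : P → Y) (f : X → Z) (g : Y → Z)
    (hcomm : ∀ c, f (p₁ c) = g (p₂ c)) (h : ∀ x y, f x = g y → ∃! c, p₁ c = x ∧ p₂ c = y) (a : X → C)
    (y : Y) :
    fibreProd f a (g y) = fibreProd p₂ (a ∘ p₁) y := by
  classical
  simp only [fibreProd_apply]
  symm
  refine Finset.prod_bij (fun c _ => p₁ c) ?_ ?_ ?_ fun _ _ => rfl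
  · intro c hc
    simp only [Finset.mem_filter, Finset.mem_univ, true_and] at hc ⊢
    rw [hcomm, hc]
  · intro c hc d hd hcd
    simp only [Finset.mem_filter, Finset.mem_univ, true_and] at hc hd
    exact (h _ _ ((hcomm d).trans (congrArg g hd))).unique ⟨hcd, hc⟩ ⟨rfl, hd⟩
  · intro x hx
    simp only [Finset.mem_filter, Finset.mem_univ, true_and] at hx
    obtain ⟨c, hc, -⟩ := h _ _ hx
    exact ⟨c, by simpa using hc.2, hc.1⟩

end Fibre

namespace FinGSet

variable {G : Type v} [Group G]

theorem bijective_restrict_of_isDisjointUnion {C : Type w} {X Y Z : FinGSet G} (i : X →[G] Z)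
    (j : Y →[G] Z) (h : IsDisjointUnion i j) :
    Function.Bijective fun a : Z → C => (a ∘ i, a ∘ j) := by
  constructor
  · intro a b hab
    obtain ⟨h₁, h₂⟩ := Prod.mk.inj hab
    funext z
    obtain ⟨x | y, rfl⟩ := h.2 z
    · exact congrFun h₁ x
    · exact congrFun h₂ y
  · rintro ⟨a, b⟩
    refine ⟨Sum.elim a b ∘ (Equiv.ofBijective _ h).symm, Prod.ext (funext fun x => ?_)
      (funext fun y => ?_)⟩
    · exact congrArg (Sum.elim a b) ((Equiv.ofBijective _ h).symm_apply_apply (.inl x))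
    · exact congrArg (Sum.elim a b) ((Equiv.ofBijective _ h).symm_apply_apply (.inr y))

theorem fibreProd_fibreSum {C : Type w} [CommRing C] {A X Y E P : FinGSet G} (p : A →[G] X)
    (f : X →[G] Y) (e : E →[G] A) (f' : E →[G] P) (q : P →[G] Y) (h : IsExponential p f e f' q)
    (a : A → C) : fibreProd f (fibreSum p a) = fibreSum q (fibreProd f' (a ∘ e)) := by
  classical
  funext y
  rw [fibreProd_apply_subtype, fibreSum_apply_subtype]
  simp only [fibreSum_apply_subtype]
  rw [Finset.prod_univ_sum, Fintype.piFinset_univ]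
  symm
  have hpt : ∀ (c : {c : P // q c = y}) (x : {x : X // f x = y}), ∃ z, p (e z) = x ∧ f' z = c :=
    fun c x => (h.existsUnique_point x c (x.2.trans c.2.symm)).exists
  choose z hz hz' using hpt
  have huniq : ∀ (c : {c : P // q c = y}) (x : {x : X // f x = y}) (t : E),
      p (e t) = x → f' t = c → t = z c x := fun c x t h₁ h₂ =>
    (h.existsUnique_point x c (x.2.trans c.2.symm)).unique ⟨h₁, h₂⟩ ⟨hz c x, hz' c x⟩
  refine Fintype.sum_bijective
    (fun (c : {c : P // q c = y}) (x : {x : X // f x = y}) =>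
      (⟨e (z c x), hz c x⟩ : {t : A // p t = x})) ⟨?_, ?_⟩ _ _ ?_
  · intro c d hcd
    obtain ⟨b, -, hb⟩ := h.existsUnique_section y (fun x => e (z c x)) (hz c)
    refine Subtype.ext ((hb c ⟨c.2, ?_⟩).trans (hb d ⟨d.2, ?_⟩).symm)
    · rintro t ht x hx
      rw [huniq c x t hx ht]
    · rintro t ht x hx
      rw [huniq d x t hx ht]
      exact (congrArg Subtype.val (congrFun hcd x)).symm
  · intro s
    obtain ⟨c, ⟨hc, hs⟩, -⟩ := h.existsUnique_section y (fun x => (s x).1) fun x => (s x).2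
    exact ⟨⟨c, hc⟩, funext fun x => Subtype.ext (hs _ (hz' ⟨c, hc⟩ x) x (hz ⟨c, hc⟩ x))⟩
  · intro c
    rw [fibreProd_apply_subtype]
    symm
    refine Fintype.prod_bijective (fun x => (⟨z c x, hz' c x⟩ : {t : E // f' t = c})) ⟨?_, ?_⟩ _ _
      fun _ => rfl
    · intro x x' hxx
      have h' : z c x = z c x' := congrArg Subtype.val hxx
      exact Subtype.ext (by rw [← hz c x, ← hz c x', h'])
    · rintro ⟨t, ht⟩
      have hft : f (p (e t)) = y := by rw [h.comm, ht, c.2]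
      exact ⟨⟨p (e t), hft⟩, Subtype.ext (huniq c ⟨p (e t), hft⟩ t rfl ht).symm⟩

end FinGSet

namespace TambaraFunctor

open FinGSet

variable {G : Type v} [Group G]

/-- The Tambara functor coinduced from the commutative ring `C`: its value at `X` is the ring of
all functions `X → C`. It is right adjoint to the evaluation at `G/e`. -/
noncomputable def coind (G : Type v) [Group G] (C : Type w) [CommRing C] :
    TambaraFunctor.{v, max v w} G where
  obj X := X → C
  res {X Y} f :=
    { toFun := fun a => a ∘ f
      map_one' := rfl
      map_mul' := fun _ _ => rfl
      map_zero' := rfl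
      map_add' := fun _ _ => rfl }
  tr f := fibreSum f
  nm f := fibreProd f
  res_id _ := rfl
  res_comp _ _ _ := rfl
  tr_id := fibreSum_id
  tr_comp g f := fibreSum_comp g f
  nm_id := fibreProd_id
  nm_comp g f := fibreProd_comp g f
  subsingleton_of_isEmpty _ _ := inferInstance
  bijective_of_isDisjointUnion i j h := bijective_restrict_of_isDisjointUnion i j h
  res_tr p₁ p₂ f g h a := funext fun y => fibreSum_pullback p₁ p₂ f g h.comm h.existsUnique a y
  res_nm p₁ p₂ f g h a := funext fun y => fibreProd_pullback p₁ p₂ f g h.comm h.existsUnique a y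
  tr_mul_res f a b := by
    classical
    funext y
    change fibreSum f _ y = fibreSum f a y * b y
    rw [fibreSum_apply, fibreSum_apply, Finset.sum_mul]
    refine Finset.sum_congr rfl fun x hx => ?_
    rw [← (Finset.mem_filter.1 hx).2]
    rfl
  nm_tr p f e f' q h a := fibreProd_fibreSum p f e f' q h a

@[ext]
theorem Hom.ext {S : TambaraFunctor.{v, u₁} G} {T : TambaraFunctor.{v, u₂} G} {f g : Hom S T}
    (h : ∀ X, f.app X = g.app X) : f = g := by
  cases f
  cases g
  congr 1
  exact funext h

variable [Finite G]

/-- The value of a Tambara functor at `G/e`. -/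
abbrev underlying (T : TambaraFunctor.{v, u} G) : Type u := T.obj (orbit (⊥ : Subgroup G))

/-- The morphism on values at `G/e`. -/
abbrev Hom.underlying {S : TambaraFunctor.{v, u₁} G} {T : TambaraFunctor.{v, u₂} G} (f : Hom S T) :
    S.underlying →+* T.underlying :=
  f.app (orbit (⊥ : Subgroup G))

theorem res_point_base {T : TambaraFunctor.{v, u} G} (a : T.underlying) :
    T.res (point (base G)) a = a := by
  rw [point_base_eq_id, T.res_id]

theorem res_point_res (T : TambaraFunctor.{v, u} G) {X Y : FinGSet G} (f : X →[G] Y) (x : X)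
    (a : T.obj Y) : T.res (point x) (T.res f a) = T.res (point (f x)) a := by
  rw [← T.res_comp, comp_point]

variable {C : Type w} [CommRing C]

/-- Evaluation at the base point of `G/e`. -/
def coindEval : (coind G C).underlying →+* C :=
  Pi.evalRingHom (fun _ : orbit (⊥ : Subgroup G) => C) (base G)

theorem coindEval_res_point {X : FinGSet G} (x : X) (a : (coind G C).obj X) :
    coindEval ((coind G C).res (point x) a) = a x :=
  congrArg a (point_base x)

/-- The morphism to a coinduced Tambara functor determined by a ring homomorphism on `G/e`. -/
noncomputable def toCoind {T : TambaraFunctor.{v, u} G} (h : T.underlying →+* C) :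
    Hom T (coind G C) where
  app X := RingHom.pi fun x => h.comp (T.res (point x))
  app_res f a := funext fun x => congrArg h (T.res_point_res f x a)
  app_tr f a := by
    classical
    funext y
    change h (T.res (point y) (T.tr f a)) = fibreSum f (fun x => h (T.res (point x) a)) y
    rw [fibreSum_apply, T.res_point_tr, map_sum]
  app_nm f a := by
    classical
    funext y
    change h (T.res (point y) (T.nm f a)) = fibreProd f (fun x => h (T.res (point x) a)) y
    rw [fibreProd_apply, T.res_point_nm, map_prod]

theorem toCoind_app_apply {T : TambaraFunctor.{v, u} G} (h : T.underlying →+* C) {X : FinGSet G}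
    (a : T.obj X) (x : X) : (toCoind h).app X a x = h (T.res (point x) a) := rfl

theorem coindEval_toCoind {T : TambaraFunctor.{v, u} G} (h : T.underlying →+* C)
    (a : T.underlying) : coindEval ((toCoind h).underlying a) = h a :=
  congrArg h (res_point_base a)

theorem Hom.app_eq_coindEval {T : TambaraFunctor.{v, u} G} (f : Hom T (coind G C)) {X : FinGSet G}
    (a : T.obj X) (x : X) : f.app X a x = coindEval (f.underlying (T.res (point x) a)) := by
  rw [f.app_res, coindEval_res_point]

theorem Hom.ext_coind {T : TambaraFunctor.{v, u} G} {f g : Hom T (coind G C)}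
    (h : ∀ a, coindEval (f.underlying a) = coindEval (g.underlying a)) : f = g := by
  ext X a
  funext x
  rw [f.app_eq_coindEval, g.app_eq_coindEval, h]

end TambaraFunctor

namespace TambaraFunctor

open FinGSet TensorProduct

variable {G : Type v} [Group G] {k : TambaraFunctor.{v, u} G}

namespace Mod

/-- The class of the symbol `tr_f (m ⊗ n)` in the box product. -/
def boxMk {M : Mod.{v, u, w₁} k} {N : Mod.{v, u, w₂} k} {X Y : FinGSet G} (f : Y →[G] X)
    (m : M.obj Y) (n : N.obj Y) : Box M N X :=
  QuotientAddGroup.mk (boxGen M N f m n)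

theorem boxMk_eq_of_rel {M : Mod.{v, u, w₁} k} {N : Mod.{v, u, w₂} k} {X : FinGSet G}
    {a b : FreeAbelianGroup (BoxSymbol M N X)} (h : BoxRel M N X (a - b)) :
    (QuotientAddGroup.mk a : Box M N X) = QuotientAddGroup.mk b := by
  rw [QuotientAddGroup.eq_iff_sub_mem]
  exact AddSubgroup.subset_closure h

theorem boxMap_boxMk {M : Mod.{v, u, w₁} k} {N : Mod.{v, u, w} k} {N' : Mod.{v, u, w₂} k}
    (g : Hom N N') {X Y : FinGSet G} (f : Y →[G] X) (m : M.obj Y) (n : N.obj Y) :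
    boxMap M g X (boxMk f m n) = boxMk f m (g.app Y n) :=
  congrArg QuotientAddGroup.mk (FreeAbelianGroup.map_of_apply _)

variable [Finite G]

/-- The value of a module at `G/e`. -/
abbrev underlying (M : Mod.{v, u, w} k) : Type w := M.obj (orbit (⊥ : Subgroup G))

section Coind

variable (k) (N : Type w) [AddCommGroup N] [Module k.underlying N]

/-- The action of `k(X)` on functions `X → N`, acting at `x` through the restriction to `x`. -/
abbrev coindModule (X : FinGSet G) : Module (k.obj X) (X → N) where
  smul a n := fun x => k.res (point x) a • n x
  one_smul n := funext fun x => by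
    change k.res (point x) 1 • n x = n x
    rw [map_one, one_smul]
  mul_smul a b n := funext fun x => by
    change k.res (point x) (a * b) • n x = k.res (point x) a • k.res (point x) b • n x
    rw [map_mul, mul_smul]
  smul_zero a := funext fun x => smul_zero _
  smul_add a n n' := funext fun x => smul_add _ _ _
  add_smul a b n := funext fun x => by
    change k.res (point x) (a + b) • n x = k.res (point x) a • n x + k.res (point x) b • n x
    rw [map_add, add_smul]
  zero_smul n := funext fun x => by
    change k.res (point x) 0 • n x = 0
    rw [map_zero, zero_smul]

/-- The `k`-module coinduced from a `k(G/e)`-module `N`: its value at `X` is the group of all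
functions `X → N`. It is right adjoint to the evaluation at `G/e`. -/
noncomputable def coind : Mod.{v, u, max v w} k where
  obj X := X → N
  module X := coindModule k N X
  res {X Y} f :=
    { toFun := fun a => a ∘ f
      map_zero' := rfl
      map_add' := fun _ _ => rfl }
  tr f := fibreSum f
  res_id _ := rfl
  res_comp _ _ _ := rfl
  tr_id := fibreSum_id
  tr_comp g f := fibreSum_comp g f
  subsingleton_of_isEmpty _ _ := inferInstance
  bijective_of_isDisjointUnion i j h := bijective_restrict_of_isDisjointUnion i j h
  res_tr p₁ p₂ f g h a := funext fun y => fibreSum_pullback p₁ p₂ f g h.comm h.existsUnique a y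
  res_smul f a m := funext fun x => by
    change k.res (point (f x)) a • m (f x) = k.res (point x) (k.res f a) • m (f x)
    rw [k.res_point_res]
  tr_res_smul f a m := funext fun y => by
    classical
    change fibreSum f (fun x => k.res (point x) (k.res f a) • m x) y =
      k.res (point y) a • fibreSum f m y
    rw [fibreSum_apply, fibreSum_apply, Finset.smul_sum]
    refine Finset.sum_congr rfl fun x hx => ?_
    rw [k.res_point_res, (Finset.mem_filter.1 hx).2]
  tr_smul_res f a m := funext fun y => by
    classical
    change fibreSum f (fun x => k.res (point x) a • m (f x)) y = k.res (point y) (k.tr f a) • m y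
    rw [fibreSum_apply, k.res_point_tr, Finset.sum_smul]
    refine Finset.sum_congr rfl fun x hx => ?_
    rw [(Finset.mem_filter.1 hx).2]

variable {k N} {N' : Type w₁} [AddCommGroup N'] [Module k.underlying N']

/-- Functoriality of coinduction. -/
def coindMap (g : N →ₗ[k.underlying] N') : Hom (coind k N) (coind k N') where
  app X :=
    { toFun := fun n x => g (n x)
      map_add' := fun n n' => funext fun x => map_add g (n x) (n' x)
      map_smul' := fun a n => funext fun x => map_smul g (k.res (point x) a) (n x) }
  app_res _ _ := rfl
  app_tr f n := by
    classical
    funext y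
    exact map_sum g (fun x => n x) {x | f x = y}

end Coind

variable (M : Mod.{v, u, w₁} k) (N : Type w) [AddCommGroup N] [Module k.underlying N]

open Classical in
/-- The evaluation of the box product with a coinduced module at the base point of `G/e`. -/
noncomputable def boxCoindEval :
    Box M (coind k N) (orbit (⊥ : Subgroup G)) →+ M.underlying ⊗[k.underlying] N :=
  QuotientAddGroup.lift _
    (FreeAbelianGroup.lift fun s : BoxSymbol M (coind k N) (orbit (⊥ : Subgroup G)) =>
      fibreSum s.2.1 (fun y => M.res (point y) s.2.2.1 ⊗ₜ[k.underlying] s.2.2.2 y) (base G)) <| by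
    rw [AddSubgroup.closure_le]
    have key : ∀ {Y : FinGSet G} (f : Y →[G] orbit (⊥ : Subgroup G)) (m : M.obj Y)
        (n : (coind k N).obj Y),
        FreeAbelianGroup.lift (fun s : BoxSymbol M (coind k N) (orbit (⊥ : Subgroup G)) =>
          fibreSum s.2.1 (fun y => M.res (point y) s.2.2.1 ⊗ₜ[k.underlying] s.2.2.2 y) (base G))
          (boxGen M (coind k N) f m n) =
        fibreSum f (fun y => M.res (point y) m ⊗ₜ[k.underlying] n y) (base G) :=
      fun _ _ _ => FreeAbelianGroup.lift_apply_of _ _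
    intro z hz
    rw [SetLike.mem_coe, AddMonoidHom.mem_ker]
    cases hz with
    | add_left f m m' n =>
      rw [map_sub, map_add, key, key, key, sub_eq_zero, ← Pi.add_apply, ← map_add]
      refine congrFun (congrArg (fibreSum f) (funext fun y => ?_)) (base G)
      rw [map_add, add_tmul]
      rfl
    | add_right f m n n' =>
      rw [map_sub, map_add, key, key, key, sub_eq_zero, ← Pi.add_apply, ← map_add]
      refine congrFun (congrArg (fibreSum f) (funext fun y => ?_)) (base G)
      exact tmul_add _ _ _
    | smul f a m n =>
      rw [map_sub, key, key, sub_eq_zero]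
      refine congrFun (congrArg (fibreSum f) (funext fun y => ?_)) (base G)
      rw [M.res_smul]
      exact smul_tmul _ _ _
    | tr_left f h m n =>
      rw [map_sub, key, key, sub_eq_zero]
      change _ = fibreSum (f ∘ h) _ _
      rw [fibreSum_comp]
      refine congrFun (congrArg (fibreSum f) (funext fun y => ?_)) (base G)
      rw [M.res_point_tr, sum_tmul, fibreSum_apply]
      refine Finset.sum_congr rfl fun x hx => ?_
      rw [← (Finset.mem_filter.1 hx).2]
      rfl
    | tr_right f h m n =>
      rw [map_sub, key, key, sub_eq_zero]
      change _ = fibreSum (f ∘ h) _ _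
      rw [fibreSum_comp]
      refine congrFun (congrArg (fibreSum f) (funext fun y => ?_)) (base G)
      refine (tmul_sum (M.res (point y) m) {x | h x = y} fun x => n x).trans ?_
      rw [fibreSum_apply]
      refine Finset.sum_congr rfl fun x hx => ?_
      rw [← M.res_comp, comp_point, (Finset.mem_filter.1 hx).2]

theorem boxCoindEval_boxMk {Y : FinGSet G} (f : Y →[G] orbit (⊥ : Subgroup G)) (m : M.obj Y)
    (n : (coind k N).obj Y) : boxCoindEval M N (boxMk f m n) =
      fibreSum f (fun y => M.res (point y) m ⊗ₜ[k.underlying] n y) (base G) :=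
  FreeAbelianGroup.lift_apply_of _ _

open Classical in
/-- The function on `G/e` supported at the base point. -/
noncomputable def coindSingle : N →+ (coind k N).underlying :=
  AddMonoidHom.single (fun _ : orbit (⊥ : Subgroup G) => N) (base G)

theorem coindSingle_smul (a : k.underlying) (n : N) :
    coindSingle (k := k) N (a • n) = a • coindSingle N n := by
  classical
  funext q
  change Pi.single (M := fun _ => N) (base G) (a • n) q =
    k.res (point q) a • Pi.single (M := fun _ => N) (base G) n q
  by_cases h : q = base G
  · subst h
    rw [Pi.single_eq_same, Pi.single_eq_same, res_point_base]
  · rw [Pi.single_eq_of_ne h, Pi.single_eq_of_ne h, smul_zero]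

/-- The section of `boxCoindEval`. -/
noncomputable def boxCoindSection :
    M.underlying ⊗[k.underlying] N →+ Box M (coind k N) (orbit (⊥ : Subgroup G)) :=
  TensorProduct.liftAddHom
    (AddMonoidHom.mk' (fun m => AddMonoidHom.mk'
      (fun n => boxMk (MulActionHom.id G) m (coindSingle N n))
      fun n n' => by
        rw [map_add]
        exact boxMk_eq_of_rel (.add_right ..))
      fun m m' => by
        ext n
        exact boxMk_eq_of_rel (.add_left ..))
    fun a m n => by
      change boxMk _ _ _ = boxMk _ _ (coindSingle N (a • n))
      rw [coindSingle_smul]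
      exact boxMk_eq_of_rel (.smul ..)

theorem boxCoindSection_tmul (m : M.underlying) (n : N) :
    boxCoindSection M N (m ⊗ₜ n) = boxMk (MulActionHom.id G) m (coindSingle N n) := rfl

theorem boxCoindEval_boxCoindSection (t : M.underlying ⊗[k.underlying] N) :
    boxCoindEval M N (boxCoindSection M N t) = t := by
  classical
  induction t with
  | zero => rw [map_zero, map_zero]
  | add t t' h h' => rw [map_add, map_add, h, h']
  | tmul m n =>
    rw [boxCoindSection_tmul, boxCoindEval_boxMk]
    refine (congrFun (fibreSum_id _) (base G)).trans ?_
    rw [point_base_eq_id, M.res_id]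
    exact congrArg (m ⊗ₜ[k.underlying] ·) (Pi.single_eq_same (M := fun _ => N) (base G) n)

variable {N} in
theorem boxMap_boxCoindSection {N' : Type w₂} [AddCommGroup N'] [Module k.underlying N']
    (g : N →ₗ[k.underlying] N') (t : M.underlying ⊗[k.underlying] N) :
    boxMap M (coindMap g) _ (boxCoindSection M N t) =
      boxCoindSection M N' (g.lTensor M.underlying t) := by
  classical
  induction t with
  | zero => simp only [map_zero]
  | add t t' h h' => simp only [map_add, h, h']
  | tmul m n =>
    rw [LinearMap.lTensor_tmul, boxCoindSection_tmul, boxCoindSection_tmul, boxMap_boxMk]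
    congr 1
    funext q
    exact Pi.apply_single (fun _ => g) (fun _ => map_zero g) (base G) n q

/-- The value at `G/e` of a flat `k`-module is flat over `k(G/e)`. -/
theorem IsFlat.underlying {M : Mod.{v, u, w₁} k} (hM : M.IsFlat) :
    Module.Flat k.underlying M.underlying := by
  rw [Module.Flat.iff_lTensor_injective']
  intro I t t' htt
  have hex := hM (coind k I) (coind k k.underlying) (coind k (k.underlying ⧸ I))
    (coindMap I.subtype) (coindMap I.mkQ) fun X => ⟨?_, ?_, ?_⟩
  · have h := congrArg (boxCoindSection M k.underlying) htt
    rw [← boxMap_boxCoindSection, ← boxMap_boxCoindSection] at h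
    have h' := congrArg (boxCoindEval M I) ((hex _).1 h)
    rwa [boxCoindEval_boxCoindSection, boxCoindEval_boxCoindSection] at h'
  · intro n n' h
    funext x
    exact Subtype.ext (congrFun h x)
  · intro n
    constructor
    · intro h
      exact ⟨fun x => ⟨n x, (Submodule.Quotient.mk_eq_zero I).1 (congrFun h x)⟩, rfl⟩
    · rintro ⟨n, rfl⟩
      funext x
      exact (Submodule.Quotient.mk_eq_zero I).2 (n x).2
  · intro n
    exact ⟨fun x => (n x).out, funext fun x => Quotient.out_eq (n x)⟩

end Mod

theorem Hom.underlying_flat [Finite G] {R : TambaraFunctor.{v, u₁} G} (φ : Hom k R)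
    (h : φ.toMod.IsFlat) :
    φ.underlying.Flat :=
  h.underlying

end TambaraFunctor

namespace TambaraFunctor

open FinGSet

variable {G : Type v} [Group G]

/-- The class of a generator in a presented Tambara functor. -/
def Presented.gen {Gen : FinGSet G → Type w} (rel : ∀ X, Term Gen X → Term Gen X → Prop)
    {X : FinGSet G} (x : Gen X) : (Presented rel).obj X :=
  Quotient.mk (termSetoid rel X) (.gen x)

theorem Presented.hom_ext {Gen : FinGSet G → Type w} {rel : ∀ X, Term Gen X → Term Gen X → Prop}
    {T : TambaraFunctor.{v, u} G} {f g : Hom (Presented rel) T}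
    (h : ∀ X (x : Gen X), f.app X (Presented.gen rel x) = g.app X (Presented.gen rel x)) :
    f = g := by
  ext X a
  obtain ⟨t⟩ := a
  clear a
  induction t with
  | gen x => exact h _ x
  | zero => exact (map_zero (f.app _)).trans (map_zero (g.app _)).symm
  | one => exact (map_one (f.app _)).trans (map_one (g.app _)).symm
  | add a b iha ihb =>
    exact (map_add (f.app _) _ _).trans
      ((congrArg₂ (· + ·) iha ihb).trans (map_add (g.app _) _ _).symm)
  | mul a b iha ihb =>
    exact (map_mul (f.app _) _ _).trans
      ((congrArg₂ (· * ·) iha ihb).trans (map_mul (g.app _) _ _).symm)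
  | neg a iha =>
    exact (map_neg (f.app _) _).trans ((congrArg _ iha).trans (map_neg (g.app _) _).symm)
  | res p a iha => exact (f.app_res p _).trans ((congrArg _ iha).trans (g.app_res p _).symm)
  | tr p a iha => exact (f.app_tr p _).trans ((congrArg _ iha).trans (g.app_tr p _).symm)
  | nm p a iha => exact (f.app_nm p _).trans ((congrArg _ iha).trans (g.app_nm p _).symm)

section BoxAlg

variable {k : TambaraFunctor.{v, u} G} {R : TambaraFunctor.{v, u₁} G}
  {S : TambaraFunctor.{v, u₂} G} (φ : Hom k R) (ψ : Hom k S)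

/-- The left inclusion `R → R ⊠_k S`. -/
def boxInl : Hom R (boxAlg φ ψ) where
  app _ := RingHom.mk'
    { toFun := fun a => Presented.gen (BoxAlgRel φ ψ) (.inl a)
      map_one' := Quotient.sound (.of .inl_one)
      map_mul' := fun a b => Quotient.sound (.of (.inl_mul a b)) }
    fun a b => Quotient.sound (.of (.inl_add a b))
  app_res f a := Quotient.sound (.of (.inl_res f a))
  app_tr f a := Quotient.sound (.of (.inl_tr f a))
  app_nm f a := Quotient.sound (.of (.inl_nm f a))

/-- The right inclusion `S → R ⊠_k S`. -/
def boxInr : Hom S (boxAlg φ ψ) where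
  app _ := RingHom.mk'
    { toFun := fun a => Presented.gen (BoxAlgRel φ ψ) (.inr a)
      map_one' := Quotient.sound (.of .inr_one)
      map_mul' := fun a b => Quotient.sound (.of (.inr_mul a b)) }
    fun a b => Quotient.sound (.of (.inr_add a b))
  app_res f a := Quotient.sound (.of (.inr_res f a))
  app_tr f a := Quotient.sound (.of (.inr_tr f a))
  app_nm f a := Quotient.sound (.of (.inr_nm f a))

theorem boxInl_eq_boxInr {X : FinGSet G} (c : k.obj X) :
    (boxInl φ ψ).app X (φ.app X c) = (boxInr φ ψ).app X (ψ.app X c) :=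
  Quotient.sound (.of (.glue c))

theorem boxAlg_hom_ext {T : TambaraFunctor.{v, w} G} {f g : Hom (boxAlg φ ψ) T}
    (hl : f.comp (boxInl φ ψ) = g.comp (boxInl φ ψ))
    (hr : f.comp (boxInr φ ψ) = g.comp (boxInr φ ψ)) : f = g := by
  refine Presented.hom_ext ?_
  rintro X (a | b)
  · exact congrArg (fun h : Hom R T => h.app X a) hl
  · exact congrArg (fun h : Hom S T => h.app X b) hr

variable [Finite G] {C : Type w} [CommRing C]

/-- A ring homomorphism on `(R ⊠_k S)(G/e)` is determined by its restrictions to `R(G/e)` and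
`S(G/e)`. -/
theorem boxAlg_underlying_ringHom_ext {f g : (boxAlg φ ψ).underlying →+* C}
    (hl : f.comp (boxInl φ ψ).underlying = g.comp (boxInl φ ψ).underlying)
    (hr : f.comp (boxInr φ ψ).underlying = g.comp (boxInr φ ψ).underlying) : f = g := by
  have h : toCoind f = toCoind g := by
    refine boxAlg_hom_ext φ ψ (Hom.ext_coind fun a => ?_) (Hom.ext_coind fun a => ?_)
    · exact (coindEval_toCoind f _).trans
        ((RingHom.congr_fun hl a).trans (coindEval_toCoind g _).symm)
    · exact (coindEval_toCoind f _).trans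
        ((RingHom.congr_fun hr a).trans (coindEval_toCoind g _).symm)
  ext a
  rw [← coindEval_toCoind f, h, coindEval_toCoind]

/-- The ring homomorphism on `(R ⊠_k S)(G/e)` determined by ring homomorphisms on `R(G/e)` and
`S(G/e)` which agree on `k(G/e)`. -/
noncomputable def boxAlgUnderlyingLift (f : R.underlying →+* C) (g : S.underlying →+* C)
    (h : f.comp φ.underlying = g.comp ψ.underlying) : (boxAlg φ ψ).underlying →+* C :=
  coindEval.comp (boxAlgLift φ ψ (toCoind f) (toCoind g) fun X c => funext fun x => by
    rw [toCoind_app_apply, toCoind_app_apply, ← φ.app_res, ← ψ.app_res]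
    exact RingHom.congr_fun h _).underlying

theorem boxAlgUnderlyingLift_boxInl (f : R.underlying →+* C) (g : S.underlying →+* C)
    (h : f.comp φ.underlying = g.comp ψ.underlying) (a : R.underlying) :
    boxAlgUnderlyingLift φ ψ f g h ((boxInl φ ψ).underlying a) = f a :=
  coindEval_toCoind f a

theorem boxAlgUnderlyingLift_boxInr (f : R.underlying →+* C) (g : S.underlying →+* C)
    (h : f.comp φ.underlying = g.comp ψ.underlying) (a : S.underlying) :
    boxAlgUnderlyingLift φ ψ f g h ((boxInr φ ψ).underlying a) = g a :=
  coindEval_toCoind g a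

end BoxAlg

variable [Finite G]

section Ideal

variable {T : TambaraFunctor.{v, u} G} (I : TambaraIdeal T)

/-- The Tambara ideal of the elements all of whose restrictions to `G/e` lie in `𝔞`. -/
noncomputable def pointwiseIdeal (𝔞 : Ideal T.underlying) : TambaraIdeal T :=
  (toCoind (Ideal.Quotient.mk 𝔞)).ker

theorem mem_pointwiseIdeal {𝔞 : Ideal T.underlying} {X : FinGSet G} {a : T.obj X} :
    a ∈ (pointwiseIdeal 𝔞).carrier X ↔ ∀ x : X, T.res (point x) a ∈ 𝔞 := by
  simp only [← Ideal.Quotient.eq_zero_iff_mem (I := 𝔞)]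
  exact funext_iff (f := (toCoind (Ideal.Quotient.mk 𝔞)).app X a)

theorem exists_ne_of_not_injective {K H : Subgroup G} {f : orbit K →[G] orbit H}
    (hf : ¬ Function.Injective f) (y : orbit H) : ∃ p q, p ≠ q ∧ f p = y ∧ f q = y := by
  simp only [Function.Injective, not_forall] at hf
  obtain ⟨p, q, hpq, hne⟩ := hf
  obtain ⟨g, hg⟩ := MulAction.exists_smul_eq (α := G ⧸ H) G (f p) y
  exact ⟨g • p, g • q, fun h => hne (MulAction.injective g h),
    by rw [map_smul]; exact hg, by rw [map_smul, ← hpq]; exact hg⟩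

namespace TambaraIdeal

theorem containsNontrivialNorms_pointwiseIdeal :
    I.ContainsNontrivialNorms (pointwiseIdeal (I.carrier (orbit ⊥) ^ 2)) := by
  classical
  constructor
  · intro X a ha b hb
    refine mem_pointwiseIdeal.2 fun x => ?_
    rw [map_mul, pow_two]
    exact Ideal.mul_mem_mul (I.res_mem _ ha) (I.res_mem _ hb)
  · intro K H f hf a ha
    refine mem_pointwiseIdeal.2 fun y => ?_
    obtain ⟨p, q, hpq, hp, hq⟩ := exists_ne_of_not_injective hf y
    rw [T.res_point_nm, ← Finset.mul_prod_erase _ _ (a := p) (by simpa using hp),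
      ← Finset.mul_prod_erase _ _ (a := q) (by simpa using ⟨hpq.symm, hq⟩), ← mul_assoc, pow_two]
    exact Ideal.mul_mem_right _ _ (Ideal.mul_mem_mul (I.res_mem _ ha) (I.res_mem _ ha))

theorem mul_mem_gtOne {X : FinGSet G} {a b : T.obj X} (ha : a ∈ I.carrier X)
    (hb : b ∈ I.carrier X) : a * b ∈ I.gtOne.carrier X :=
  Submodule.mem_iInf _ |>.2 fun J => J.2.1 X a ha b hb

/-- At `G/e`, the ideal `I^{>1}` is the square of `I`. -/
theorem gtOne_underlying : I.gtOne.carrier (orbit ⊥) = I.carrier (orbit ⊥) ^ 2 := by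
  apply le_antisymm
  · intro a ha
    have h := mem_pointwiseIdeal.1 ((Submodule.mem_iInf _).1 ha
      ⟨_, I.containsNontrivialNorms_pointwiseIdeal⟩) (base G)
    rwa [res_point_base] at h
  · rw [pow_two, Ideal.mul_le]
    exact fun a ha b hb => I.mul_mem_gtOne ha hb

variable {I}

/-- If the transfers from `G/e` are surjective, then an ideal which is contained at `G/e` in
another is contained in it. -/
theorem le_of_underlying_le {J : TambaraIdeal T}
    (htr : ∀ H : Subgroup G, ∃ x, T.tr (proj (bot_le : ⊥ ≤ H)) x = 1)
    (h : I.carrier (orbit ⊥) ≤ J.carrier (orbit ⊥)) (X : FinGSet G) :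
    I.carrier X ≤ J.carrier X := by
  intro a ha
  refine (Hom.id T).toMod.mem_of_cover (fun X => (J.carrier X).toAddSubgroup)
    (fun f m hm => J.res_mem f hm) (fun f m hm => J.tr_mem f hm) a fun z => ?_
  let i : orbit (MulAction.stabilizer G z) →[G] X :=
    { toFun := MulAction.ofQuotientStabilizer G z
      map_smul' := MulAction.ofQuotientStabilizer_smul G z }
  refine ⟨_, i, MulAction.injective_ofQuotientStabilizer G z, ⟨QuotientGroup.mk 1, ?_⟩, ?_⟩
  · exact one_smul G z
  · change T.res i a ∈ J.carrier _
    obtain ⟨x, hx⟩ := htr (MulAction.stabilizer G z)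
    rw [← one_mul (T.res i a), ← hx, ← T.tr_mul_res]
    exact J.tr_mem _ (Ideal.mul_mem_left _ _ (h (I.res_mem _ (I.res_mem _ ha))))

end TambaraIdeal

end Ideal

theorem subsingleton_kahlerDifferentials_iff {k : TambaraFunctor.{v, u₁} G}
    {R : TambaraFunctor.{v, u₂} G} (φ : Hom k R) (X : FinGSet G) :
    Subsingleton (KahlerDifferentials φ X) ↔
      (mulHom φ).ker.carrier X ≤ (mulHom φ).ker.gtOne.carrier X := by
  rw [Submodule.Quotient.subsingleton_iff, Submodule.comap_subtype_eq_top]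

theorem subsingleton_kahlerDifferentials_underlying_iff {k : TambaraFunctor.{v, u₁} G}
    {R : TambaraFunctor.{v, u₂} G} (φ : Hom k R) :
    Subsingleton (KahlerDifferentials φ (orbit ⊥)) ↔ φ.underlying.FormallyUnramified := by
  rw [subsingleton_kahlerDifferentials_iff, TambaraIdeal.gtOne_underlying]
  set I := (mulHom φ).ker.carrier (orbit ⊥) with hI
  let := φ.underlying.toAlgebra
  have hdiff : ∀ b, (boxInl φ φ).underlying b - (boxInr φ φ).underlying b ∈ I := fun b => by
    rw [hI]
    change (mulHom φ).underlying _ = 0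
    rw [map_sub, sub_eq_zero]
    rfl
  change _ ↔ Algebra.FormallyUnramified k.underlying R.underlying
  constructor
  · intro h
    rw [Algebra.FormallyUnramified.iff_comp_injective]
    intro C _ _ J hJ g₁ g₂ hg
    let γ : (boxAlg φ φ).underlying →+* C := boxAlgUnderlyingLift φ φ g₁ g₂
      (g₁.comp_algebraMap.trans g₂.comp_algebraMap.symm)
    have hγ₁ : ∀ b, γ ((boxInl φ φ).underlying b) = g₁ b := boxAlgUnderlyingLift_boxInl _ _ _ _ _
    have hγ₂ : ∀ b, γ ((boxInr φ φ).underlying b) = g₂ b := boxAlgUnderlyingLift_boxInr _ _ _ _ _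
    have hmod : (Ideal.Quotient.mk J).comp γ =
        ((Ideal.Quotient.mk J).comp (g₁ : R.underlying →+* C)).comp (mulHom φ).underlying := by
      refine boxAlg_underlying_ringHom_ext φ φ (RingHom.ext fun b => ?_) (RingHom.ext fun b => ?_)
      · exact congrArg (Ideal.Quotient.mk J) (hγ₁ b)
      · exact (congrArg (Ideal.Quotient.mk J) (hγ₂ b)).trans (AlgHom.congr_fun hg b).symm
    have hle : I ≤ J.comap γ := by
      intro t ht
      rw [Ideal.mem_comap, ← Ideal.Quotient.eq_zero_iff_mem]
      refine (RingHom.congr_fun hmod t).trans ?_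
      have h0 : (mulHom φ).underlying t = 0 := ht
      rw [RingHom.comp_apply, h0, map_zero]
    ext b
    rw [← hγ₁, ← hγ₂, ← sub_eq_zero, ← map_sub]
    have h2 : (boxInl φ φ).underlying b - (boxInr φ φ).underlying b ∈ (J ^ 2).comap γ :=
      (Ideal.le_comap_pow γ 2) ((Ideal.pow_right_mono hle 2) (h (hdiff b)))
    rwa [hJ, Ideal.mem_comap, Ideal.mem_bot] at h2
  · intro h
    let π := Ideal.Quotient.mk (I ^ 2)
    let : Algebra k.underlying ((boxAlg φ φ).underlying ⧸ I ^ 2) :=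
      ((π.comp (boxInl φ φ).underlying).comp φ.underlying).toAlgebra
    let g₁ : R.underlying →ₐ[k.underlying] (boxAlg φ φ).underlying ⧸ I ^ 2 :=
      { π.comp (boxInl φ φ).underlying with commutes' := fun _ => rfl }
    let g₂ : R.underlying →ₐ[k.underlying] (boxAlg φ φ).underlying ⧸ I ^ 2 :=
      { π.comp (boxInr φ φ).underlying with
        commutes' := fun c => congrArg π (boxInl_eq_boxInr φ φ c).symm }
    have hg : g₁ = g₂ := by
      refine Algebra.FormallyUnramified.ext (I.map π) ⟨2, ?_⟩ fun b => ?_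
      · rw [← Ideal.map_pow]
        exact Ideal.map_quotient_self _
      · rw [Ideal.Quotient.mk_eq_mk_iff_sub_mem]
        change π _ - π _ ∈ _
        rw [← map_sub]
        exact Ideal.mem_map_of_mem π (hdiff b)
    have hid : (π.comp (boxInl φ φ).underlying).comp (mulHom φ).underlying = π := by
      refine boxAlg_underlying_ringHom_ext φ φ (RingHom.ext fun b => rfl) (RingHom.ext fun b => ?_)
      exact AlgHom.congr_fun hg b
    intro t ht
    rw [← Ideal.Quotient.eq_zero_iff_mem]
    refine (RingHom.congr_fun hid t).symm.trans ?_
    have h0 : (mulHom φ).underlying t = 0 := ht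
    rw [RingHom.comp_apply, h0, map_zero]

theorem exists_tr_eq_one {T : TambaraFunctor.{v, u} G}
    (h : (T.IsCohomological ∧ IsUnit (Nat.card G : T.obj (orbit (⊤ : Subgroup G)))) ∨
      T.TransfersSurjective) (H : Subgroup G) :
    ∃ x, T.tr (proj (bot_le : ⊥ ≤ H)) x = 1 := by
  obtain ⟨hc, hu⟩ | hs := h
  · have hG : IsUnit (Nat.card G : T.obj (orbit H)) := by
      simpa using hu.map (T.res (proj (le_top : H ≤ ⊤)))
    obtain ⟨b, hb⟩ := (isUnit_of_dvd_unit (Nat.cast_dvd_cast H.card_subgroup_dvd_card)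
      hG).exists_right_inv
    exact ⟨_, (hc ⊥ H bot_le b).trans (by rw [Subgroup.relIndex_bot_left, hb])⟩
  · exact hs ⊥ H bot_le 1

/-- If the transfers of `R` from `G/e` are surjective, then the genuine Kähler differentials vanish
if and only if those of the ring homomorphism on values at `G/e` vanish. -/
theorem forall_subsingleton_kahlerDifferentials_iff {k : TambaraFunctor.{v, u₁} G}
    {R : TambaraFunctor.{v, u₂} G} (φ : Hom k R)
    (h : ∀ H : Subgroup G, ∃ x, R.tr (proj (bot_le : ⊥ ≤ H)) x = 1) :
    (∀ X, Subsingleton (KahlerDifferentials φ X)) ↔ φ.underlying.FormallyUnramified := by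
  rw [← subsingleton_kahlerDifferentials_underlying_iff]
  refine ⟨fun h => h _, fun he X => ?_⟩
  rw [subsingleton_kahlerDifferentials_iff] at he ⊢
  refine TambaraIdeal.le_of_underlying_le (fun H => ?_) he X
  obtain ⟨x, hx⟩ := h H
  exact ⟨(boxInl φ φ).app _ x, by rw [← (boxInl φ φ).app_tr, hx, map_one]⟩

end TambaraFunctor

namespace TambaraFunctor

open FinGSet

variable {G : Type v} [Group G] [Finite G]

section Adjunction

variable {T : TambaraFunctor.{v, u} G} {S : TambaraFunctor.{v, u₁} G} {C : Type w} [CommRing C]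

theorem toCoind_comp (h : T.underlying →+* C) (f : Hom S T) :
    (toCoind h).comp f = toCoind (h.comp f.underlying) :=
  Hom.ext_coind fun a =>
    (coindEval_toCoind h (f.underlying a)).trans (coindEval_toCoind (h.comp f.underlying) a).symm

theorem toCoind_injective : Function.Injective (toCoind : (T.underlying →+* C) → _) := by
  intro f g h
  ext a
  rw [← coindEval_toCoind f, h, coindEval_toCoind]

end Adjunction

/-- The value at `G/e` of the free polynomial algebra on generators `x i` in levels `X i` has the
universal property of the polynomial ring in the restrictions of the `x i`. -/
theorem IsFreePolynomial.existsUnique_underlying {k : TambaraFunctor.{v, u} G}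
    {F : TambaraFunctor.{v, max (v + 1) u} G} {φ : Hom k F} {I : Type} {X : I → FinGSet G}
    {x : ∀ i, F.obj (X i)} (hF : IsFreePolynomial φ X x) {C : Type (max (v + 1) u)} [CommRing C]
    (g : k.underlying →+* C) (s : ∀ i, X i → C) :
    ∃! h : F.underlying →+* C, h.comp φ.underlying = g ∧
      ∀ i p, h (F.res (point p) (x i)) = s i p := by
  obtain ⟨h, ⟨hk, hx⟩, huniq⟩ := hF (coind G C) (toCoind g) s
  refine ⟨coindEval.comp h.underlying, ⟨RingHom.ext fun a => ?_, fun i p => ?_⟩, ?_⟩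
  · rw [← coindEval_toCoind g, ← hk]
    rfl
  · rw [RingHom.comp_apply, ← h.app_eq_coindEval, hx]
  · rintro h' ⟨hk', hx'⟩
    have hh : toCoind h' = h :=
      huniq _ ⟨by rw [toCoind_comp, hk'], fun i => funext fun p => hx' i p⟩
    ext a
    rw [← hh]
    exact (coindEval_toCoind h' a).symm

theorem IsFreePolynomial.finitePresentation {k : TambaraFunctor.{v, u} G}
    {F : TambaraFunctor.{v, max (v + 1) u} G} {φ : Hom k F} {I : Type} [Finite I]
    {X : I → FinGSet G} {x : ∀ i, F.obj (X i)} (hF : IsFreePolynomial φ X x) :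
    φ.underlying.FinitePresentation := by
  let P := MvPolynomial (Σ i, X i) k.underlying
  let Γ : P →+* F.underlying :=
    MvPolynomial.eval₂Hom φ.underlying fun ip => F.res (point ip.2) (x ip.1)
  have hΓC : Γ.comp MvPolynomial.C = φ.underlying := by
    ext a
    exact MvPolynomial.eval₂Hom_C _ _ a
  have hΓX : ∀ i p, Γ (MvPolynomial.X ⟨i, p⟩) = F.res (point p) (x i) := fun i p =>
    MvPolynomial.eval₂Hom_X' _ _ _
  let e : ULift.{max (v + 1) u} P ≃+* P := ULift.ringEquiv
  obtain ⟨h, ⟨hk, hx⟩, -⟩ := hF.existsUnique_underlying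
    ((e.symm : P →+* _).comp MvPolynomial.C) fun i p => e.symm (MvPolynomial.X ⟨i, p⟩)
  let Δ : F.underlying →+* P := (e : _ →+* P).comp h
  have hΔΓ : Δ.comp Γ = RingHom.id P := by
    refine MvPolynomial.ringHom_ext (fun a => ?_) fun ip => ?_
    · have h1 : h (φ.underlying a) = e.symm (MvPolynomial.C a) := RingHom.congr_fun hk a
      have h2 : Γ (MvPolynomial.C a) = φ.underlying a := RingHom.congr_fun hΓC a
      change e (h (Γ _)) = _
      rw [h2, h1, e.apply_symm_apply]
      rfl
    · change e (h (Γ _)) = _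
      rw [hΓX ip.1 ip.2, hx, e.apply_symm_apply]
      rfl
  have hΓΔ : Γ.comp Δ = RingHom.id _ := by
    refine (hF.existsUnique_underlying φ.underlying fun i p => F.res (point p) (x i)).unique
      ⟨RingHom.ext fun a => ?_, fun i p => ?_⟩ ⟨rfl, fun _ _ => rfl⟩
    · have h1 : h (φ.underlying a) = e.symm (MvPolynomial.C a) := RingHom.congr_fun hk a
      change Γ (e (h _)) = _
      rw [h1, e.apply_symm_apply]
      exact RingHom.congr_fun hΓC a
    · change Γ (e (h _)) = _
      rw [hx, e.apply_symm_apply, hΓX]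
  rw [← hΓC]
  have hΓ : Function.Bijective Γ :=
    Function.bijective_iff_has_inverse.2 ⟨Δ, RingHom.congr_fun hΔΓ, RingHom.congr_fun hΓΔ⟩
  exact .comp (.of_bijective hΓ) (RingHom.finitePresentation_algebraMap.2
    (inferInstanceAs (Algebra.FinitePresentation k.underlying P)))

/-- The value at `G/e` of a finitely presented algebra is finitely presented. -/
theorem Hom.FinitelyPresented.underlying {k R : TambaraFunctor.{v, u} G} {φ : Hom k R}
    (hφ : φ.FinitelyPresented) : φ.underlying.FinitePresentation := by
  obtain ⟨I, J, _, _, X, Y, F₁, F₂, φ₁, φ₂, x, y, f, g, q, hF₁, hF₂, hf, hg, hq, hfg, huniv⟩ := hφ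
  have hqfg : q.underlying.comp f.underlying = q.underlying.comp g.underlying :=
    congrArg Hom.underlying hfg
  let d (ip : Σ i, X i) : F₂.underlying :=
    f.underlying (F₁.res (point ip.2) (x ip.1)) - g.underlying (F₁.res (point ip.2) (x ip.1))
  let 𝔞 : Ideal F₂.underlying := Ideal.span (Set.range d)
  let π := Ideal.Quotient.mk 𝔞
  have hπ : π.comp f.underlying = π.comp g.underlying := by
    refine (hF₁.existsUnique_underlying (π.comp φ₂.underlying)
      fun i p => π (f.underlying (F₁.res (point p) (x i)))).unique
      ⟨?_, fun _ _ => rfl⟩ ⟨?_, fun i p => ?_⟩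
    · rw [← hf]; rfl
    · rw [← hg]; rfl
    · exact ((Ideal.Quotient.mk_eq_mk_iff_sub_mem _ _).2
        (Ideal.subset_span (Set.mem_range_self (f := d) ⟨i, p⟩))).symm
  have hle : 𝔞 ≤ RingHom.ker q.underlying := by
    rw [Ideal.span_le]
    rintro _ ⟨ip, rfl⟩
    change q.underlying _ = 0
    rw [map_sub, sub_eq_zero]
    exact RingHom.congr_fun hqfg _
  obtain ⟨r, ⟨-, hr⟩, -⟩ := huniv (coind G (F₂.underlying ⧸ 𝔞)) _ (toCoind π) rfl (by
    rw [toCoind_comp, toCoind_comp, hπ])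
  let ρ : R.underlying →+* F₂.underlying ⧸ 𝔞 := coindEval.comp r.underlying
  have hρ : ρ.comp q.underlying = π := by
    ext a
    rw [← coindEval_toCoind π, ← hr]
    rfl
  let qbar : F₂.underlying ⧸ 𝔞 →+* R.underlying := Ideal.Quotient.lift 𝔞 q.underlying hle
  have hqbar : qbar.comp π = q.underlying := RingHom.ext fun a => rfl
  let up : R.underlying →+* ULift.{max (v + 1) u} R.underlying :=
    (ULift.ringEquiv (R := R.underlying)).symm.toRingHom
  have hid : qbar.comp ρ = RingHom.id _ := by
    have h := (huniv (coind G (ULift.{max (v + 1) u} R.underlying)) _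
      (toCoind (up.comp q.underlying)) rfl (by
        rw [toCoind_comp, toCoind_comp, RingHom.comp_assoc, RingHom.comp_assoc, hqfg])).unique
      (y₁ := toCoind (up.comp (qbar.comp ρ))) (y₂ := toCoind up) ⟨?_, ?_⟩ ⟨?_, ?_⟩
    · have h' := toCoind_injective h
      ext a
      exact congrArg ULift.down (RingHom.congr_fun h' a)
    · rw [← hq, toCoind_comp, toCoind_comp, ← hqbar, ← hρ]
      rfl
    · rw [toCoind_comp, RingHom.comp_assoc, RingHom.comp_assoc, hρ, hqbar]
    · rw [← hq, toCoind_comp, toCoind_comp]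
      rfl
    · rw [toCoind_comp]
  have hker : RingHom.ker q.underlying = 𝔞 := by
    refine le_antisymm (fun a ha => ?_) hle
    rw [RingHom.mem_ker] at ha
    rw [← Ideal.Quotient.eq_zero_iff_mem]
    refine (RingHom.congr_fun hρ a).symm.trans ?_
    rw [RingHom.comp_apply, ha, map_zero]
  have hcomp : φ.underlying = q.underlying.comp φ₂.underlying := by rw [← hq]; rfl
  rw [hcomp]
  refine RingHom.FinitePresentation.comp (RingHom.FinitePresentation.of_surjective _ ?_ ?_)
    hF₂.finitePresentation
  · intro b
    obtain ⟨c, hc⟩ := Ideal.Quotient.mk_surjective (ρ b)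
    refine ⟨c, ?_⟩
    rw [← hqbar, RingHom.comp_apply, hc]
    exact RingHom.congr_fun hid b
  · rw [hker]
    exact Submodule.fg_span (Set.finite_range d)

end TambaraFunctor

theorem RingHom.Etale.of_formallyUnramified_of_flat {A B : Type*} [CommRing A] [CommRing B]
    {f : A →+* B} (hu : f.FormallyUnramified) (hf : f.Flat) (hp : f.FinitePresentation) :
    f.Etale := by
  algebraize [f]
  exact Algebra.Etale.of_formallyUnramified_of_flat

theorem RingHom.Etale.flat {A B : Type*} [CommRing A] [CommRing B]
    {f : A →+* B} (h : f.Etale) : f.Flat := by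
  algebraize [f]
  exact inferInstanceAs (Module.Flat A B)

theorem mainTheorem4 {G : Type v} [Group G] [Finite G] (k ℓ : TambaraFunctor.{v, u} G)
    (φ : TambaraFunctor.Hom k ℓ) (hflat : φ.toMod.IsFlat)
    (h : (ℓ.IsCohomological ∧ IsUnit (Nat.card G : ℓ.obj (FinGSet.orbit (⊤ : Subgroup G)))) ∨
      ℓ.TransfersSurjective) :
    (φ.FormallyEtale ↔
      (φ.app (FinGSet.orbit (⊥ : Subgroup G))).FormallyUnramified ∧
        (φ.app (FinGSet.orbit (⊥ : Subgroup G))).Flat) ∧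
    (φ.FinitelyPresented →
      (φ.Etale ↔ (φ.app (FinGSet.orbit (⊥ : Subgroup G))).Etale)) := by
  have hiff : φ.FormallyEtale ↔ φ.underlying.FormallyUnramified ∧ φ.underlying.Flat := by
    rw [← TambaraFunctor.forall_subsingleton_kahlerDifferentials_iff φ
      (TambaraFunctor.exists_tr_eq_one h)]
    exact ⟨fun hφ => ⟨hφ.1, φ.underlying_flat hflat⟩, fun hφ => ⟨hφ.1, hflat⟩⟩
  refine ⟨hiff, fun hp => ⟨fun hφ => ?_, fun hφ => ⟨hiff.2 ⟨hφ.formallyUnramified, hφ.flat⟩, hp⟩⟩⟩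
  obtain ⟨hu, hf⟩ := hiff.1 hφ.1
  exact .of_formallyUnramified_of_flat hu hf hp.underlying
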